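/- **Setting.** Let $M$ be an oriented 3-manifold with a single torus cusp, with an ideal triangulation $\mathcal T$ with tetrahedra $\Delta_1,\dots,\Delta_N$ (hence with $N$ edges $e_1,\dots,e_N$). Each pair of opposite edges of $\Delta_j$ carries one of the parameters $z_j$, $z_j'=\frac1{1-z_j}$, $z_j''=1-\frac1{z_j}$ (in the cyclic order given by the orientation), where $z\in(\mathbb C\setminus\{0,1\})^N$ is a solution of the gluing equations of all edges and of the completeness equations of all peripheral curves (for instance the one given by the complete hyperbolic structure of $M$). Put $\zeta_j=\frac1{z_j}$, $\zeta_j'=\frac1{1-z_j}$, $\zeta_j''=\frac1{z_j(z_j-1)}$. For $\square\in\{\ ,{}',{}''\}$ let $\mathbf G^\square$ be the $N\times N$ matrix whose $(i,j)$ entry is the number of edges of $\Delta_j$ with parameter $z_j^\square$ that are incident to $e_i$. A *peripheral curve* $\gamma$ is an oriented, homotopically non-trivial, simple closed curve in the peripheral torus; let $\mathbf C_\gamma,\mathbf C_\gamma',\mathbf C_\gamma''\in\mathbb Z^N$ be the coefficient vectors of its completeness equation, that is, the signed numbers of corners with the given parameter passed by $\gamma$ in the induced triangulation of the torus. Let $(f,f',f'')$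 be a combinatorial flattening: integer vectors with $\sum_\square\mathbf G^\square f^\square=(2,\dots,2)^T$, $f+f'+f''=(1,\dots,1)^T$ and $\sum_\square\mathbf C^\square_\gamma f^\square=0$ for every peripheral curve $\gamma$. The 1-loop invariant with respect to a peripheral curve $\gamma$ is $$\tau^{\mathrm{CS}}_\gamma(\mathcal T)=\frac{\det\big(\widehat{\mathbf A}\,\mathrm{diag}(\zeta)+\widehat{\mathbf B}\,\mathrm{diag}(\zeta'')\big)}{2\prod_j\zeta_j^{f_j}\zeta_j'^{f_j'}\zeta_j''^{f_j''}}\in\mathbb C/(\pm1),$$ where $\widehat{\mathbf A}=\widehat{\mathbf G}-\widehat{\mathbf G}'$, $\widehat{\mathbf B}=\widehat{\mathbf G}''-\widehat{\mathbf G}'$, and $\widehat{\mathbf G}^\square$ is $\mathbf G^\square$ with one row (say the last one) replaced by $\mathbf C^\square_\gamma$. Let $\alpha:\pi_1(M)\to\mathbb Z$ be an epimorphism such that $\alpha(\mu)=1$ for some peripheral curve $\mu$. Choose lifts $\widetilde e_i$, $\widetilde\Delta_j$ of the edges and tetrahedra to the infinite cyclic cover of $M$ belonging to $\alpha$, whose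 deck group $\mathbb Z$ is generated by the action of $\mu$, and let $\mathbf G^\square(t)=\sum_{k\in\mathbb Z}\mathbf G^\square_k t^k$, where $(\mathbf G^\square_k)_{ij}$ is the number of edges of $\mu^k\cdot\widetilde\Delta_j$ with parameter $z_j^\square$ that are incident to $\widetilde e_i$. With $\mathbf A(t)=\mathbf G(t)-\mathbf G'(t)$ and $\mathbf B(t)=\mathbf G''(t)-\mathbf G'(t)$, the twisted 1-loop invariant is $$\tau^{\mathrm{CS}}(\mathcal T,t)=\frac{\det\big(\mathbf A(t)\,\mathrm{diag}(\zeta)+\mathbf B(t)\,\mathrm{diag}(\zeta'')\big)}{\prod_j\zeta_j^{f_j}\zeta_j'^{f_j'}\zeta_j''^{f_j''}}\in\mathbb C[t^{\pm1}]/(\pm t^{\mathbb Z}).$$ The same $z$ and the same flattening are used in both invariants. **Theorem.** One has $\tau^{\mathrm{CS}}(\mathcal T,1)=0$, and for the peripheral curve $\lambda$ with $\alpha(\lambda)=0$ (unique up to isotopy and orientation), $$\left.\frac{d}{dt}\right|_{t=1}\tau^{\mathrm{CS}}(\mathcal T,t)=\tau^{\mathrm{CS}}_\lambda(\mathcal T)\quad\text{in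 }\mathbb C/(\pm1).$$ That is, every representative of $\tau^{\mathrm{CS}}(\mathcal T,t)$ vanishes at $t=1$ and has derivative $\pm\tau^{\mathrm{CS}}_\lambda(\mathcal T)$ there. -/

import Mathlib

/-!
Ideal triangulations of oriented 3-manifolds are given by their face-pairings.  The peripheral
(boundary) torus, the infinite cyclic cover, the edges, the gluing equations, the peripheral
curves, the flattenings and the (twisted) 1-loop invariants are all built from that data.
-/

open scoped LaurentPolynomial

noncomputable section

namespace TwistedNZ

/-- Oriented tetrahedra `Δ_j` (`j : ι`), each with vertices `0,1,2,3` numbered compatibly with its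
orientation, glued in pairs along all their faces.  The face `f` of `Δ_j` is the one opposite to
the vertex `f`; it is glued to a face of `Δ_(nbr j f)`.  The map `perm j f` sends the three
vertices of that face to the vertices they are glued to, and sends `f` to the (number of the) face
that it is glued to.  All face-pairings reverse orientation, i.e. all `perm j f` are odd. -/
structure Gluing (ι : Type) where
  nbr : ι → Fin 4 → ι
  perm : ι → Fin 4 → Equiv.Perm (Fin 4)
  nbr_nbr : ∀ j f, nbr (nbr j f) (perm j f f) = j
  perm_perm : ∀ j f, perm (nbr j f) (perm j f f) = (perm j f)⁻¹
  ne_self : ∀ j f, ¬ (nbr j f = j ∧ perm j f f = f)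
  odd : ∀ j f, Equiv.Perm.sign (perm j f) = -1

/-- An edge of a tetrahedron together with one of its two ends `v`; equivalently, the corner `w` of
the triangle that cuts off the ideal vertex `v` of the tetrahedron. -/
@[ext] structure Corner (ι : Type) where
  tet : ι
  v : Fin 4
  w : Fin 4
  ne : v ≠ w

/-- The same edge, with the other end. -/
def Corner.rev {ι : Type} (c : Corner ι) : Corner ι := ⟨c.tet, c.w, c.v, c.ne.symm⟩

/-- The three pairs of opposite edges of a tetrahedron (quads).  The edges of type `0`, `1`, `2`
carry the parameters `z`, `z'`, `z''`: type `0` is `{01, 23}`, type `1` is `{02, 13}`, type `2` is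
`{03, 12}`.  (A different choice of the quad type of a tetrahedron is an orientation preserving
renumbering of its vertices.) -/
def quad (v w : Fin 4) : Fin 3 :=
  if (v : ℕ) + w = 3 then 2 else if (v : ℕ) + w = 2 ∨ (v : ℕ) + w = 4 then 1 else 0

namespace Gluing

variable {ι : Type} (𝒯 : Gluing ι)

/-- Carry an edge of a tetrahedron across a face. -/
def cross (f : Fin 4) (c : Corner ι) : Corner ι :=
  ⟨𝒯.nbr c.tet f, 𝒯.perm c.tet f c.v, 𝒯.perm c.tet f c.w,
    fun h => c.ne ((𝒯.perm c.tet f).injective h)⟩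

/-- Elementary identifications of corners: through a face that contains the edge. -/
def LinkStep (c d : Corner ι) : Prop := ∃ f, f ≠ c.v ∧ f ≠ c.w ∧ d = 𝒯.cross f c

/-- Elementary identifications of (unoriented) edges of tetrahedra. -/
def EdgeStep (c d : Corner ι) : Prop := 𝒯.LinkStep c d ∨ d = c.rev

/-- The vertices of the triangulated boundary. -/
def LinkVertex : Type := Quot 𝒯.LinkStep

/-- The edges of the ideal triangulation. -/
def Edge : Type := Quot 𝒯.EdgeStep

/-- The edge of the triangulation to which a given edge of a tetrahedron belongs. -/
def edge (c : Corner ι) : 𝒯.Edge := Quot.mk _ c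

/-- The triangle `(j, v)` of the boundary cuts off the vertex `v` of `Δ_j`; two triangles are
adjacent if they share a side. -/
def LinkAdj (x y : ι × Fin 4) : Prop :=
  ∃ f, f ≠ x.2 ∧ y = (𝒯.nbr x.1 f, 𝒯.perm x.1 f x.2)

/-- The (automatically closed and oriented) boundary surface, with its `4 N` triangles and `6 N`
sides, is a single torus: it is non-empty, connected and of Euler characteristic zero. -/
structure IsOneCusped [Fintype ι] : Prop where
  nonempty : Nonempty ι
  connected : ∀ x y : ι × Fin 4, Relation.ReflTransGen 𝒯.LinkAdj x y
  euler : (Nat.card 𝒯.LinkVertex : ℤ) - 6 * Fintype.card ι + 4 * Fintype.card ι = 0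

/-- The number of edges of `Δ_j` with parameter of type `q` that are incident to the edge `E`. -/
def incidence (E : 𝒯.Edge) (j : ι) (q : Fin 3) : ℕ :=
  Set.ncard {c : Corner ι | c.tet = j ∧ c.v < c.w ∧ quad c.v c.w = q ∧ 𝒯.edge c = E}

/-- Walking once around an edge, tetrahedron by tetrahedron.  In a state `(j, π)` one is in `Δ_j`,
next to its edge with ends `π 0`, `π 1`, having entered through the face `π 2` and being about to
leave through the face `π 3`. -/
def rot (x : ι × Equiv.Perm (Fin 4)) : ι × Equiv.Perm (Fin 4) :=
  (𝒯.nbr x.1 (x.2 3), 𝒯.perm x.1 (x.2 3) * x.2 * Equiv.swap 2 3)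

/-- Integral 1-cocycles of the dual 2-complex of the ideal triangulation: `val j f` is the value on
the dual path that leaves `Δ_j` through its face `f`, and the sum of the values along every closed
walk around an edge is zero.  As the manifold retracts to the dual complex, such a cocycle is the
same as a homomorphism `α : π₁(M) → ℤ` together with lifts `Δ̃_j` of all `Δ_j` to the cover of `M`
belonging to `α` (up to a common translation): crossing the face `f` out of `Δ̃_j` leads to the
translate of the chosen lift of the neighbour by `val j f`. -/
structure Cocycle where
  val : ι → Fin 4 → ℤ
  anti : ∀ j f, val (𝒯.nbr j f) (𝒯.perm j f f) = - val j f
  closed : ∀ (x : ι × Equiv.Perm (Fin 4)) (n : ℕ), 𝒯.rot^[n] x = x →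
    ∑ i ∈ Finset.range n, val (𝒯.rot^[i] x).1 ((𝒯.rot^[i] x).2 3) = 0

/-- Integral 1-cocycles of the dual cell decomposition of the boundary surface, i.e. homomorphisms
from its fundamental group to `ℤ`: `val j v f` is the value on the dual path that leaves the
triangle `(j, v)` through its side in the face `f`. -/
structure LinkCocycle where
  val : ι → Fin 4 → Fin 4 → ℤ
  anti : ∀ j v f, f ≠ v →
    val (𝒯.nbr j f) (𝒯.perm j f v) (𝒯.perm j f f) = - val j v f
  closed : ∀ (x : ι × Equiv.Perm (Fin 4)) (n : ℕ), 𝒯.rot^[n] x = x →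
    ∑ i ∈ Finset.range n,
      val (𝒯.rot^[i] x).1 ((𝒯.rot^[i] x).2 0) ((𝒯.rot^[i] x).2 3) = 0

variable {𝒯}

/-- The triangulation of the infinite cyclic cover.  The tetrahedron `(k, j)` is the translate
`μ^k · Δ̃_j` of the chosen lift of `Δ_j`. -/
def cover (α : 𝒯.Cocycle) : Gluing (ℤ × ι) where
  nbr x f := (x.1 + α.val x.2 f, 𝒯.nbr x.2 f)
  perm x f := 𝒯.perm x.2 f
  nbr_nbr x f := by
    ext1
    · simp [α.anti]
    · simp [𝒯.nbr_nbr]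
  perm_perm x f := 𝒯.perm_perm x.2 f
  ne_self x f h := 𝒯.ne_self x.2 f ⟨congrArg Prod.snd h.1, h.2⟩
  odd x f := 𝒯.odd x.2 f

/-- The projection of an edge of a tetrahedron of the cover. -/
def _root_.TwistedNZ.Corner.proj (c : Corner (ℤ × ι)) : Corner ι := ⟨c.tet.2, c.v, c.w, c.ne⟩

/-- The projection from the edges of the infinite cyclic cover to the edges of `𝒯`. -/
def edgeProj (α : 𝒯.Cocycle) : (cover α).Edge → 𝒯.Edge :=
  Quot.map Corner.proj (by
    rintro c d (⟨f, hv, hw, rfl⟩ | rfl)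
    · exact Or.inl ⟨f, hv, hw, rfl⟩
    · exact Or.inr rfl)

variable (𝒯)

/-- Oriented closed curves in the boundary surface, in normal form with respect to its
triangulation: a cyclic sequence of arcs in triangles, each of which joins two different sides.
The `i`-th arc lies in the triangle `(tet i, frame i 0)`, cuts off the corner `frame i 1`, enters
through the side in the face `frame i 2` and leaves through the side in the face `frame i 3`. -/
structure NormalCurve where
  len : ℕ
  tet : Fin (len + 1) → ι
  frame : Fin (len + 1) → Equiv.Perm (Fin 4)
  tet_succ : ∀ i, tet (i + 1) = 𝒯.nbr (tet i) (frame i 3)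
  vertex_succ : ∀ i, frame (i + 1) 0 = 𝒯.perm (tet i) (frame i 3) (frame i 0)
  enter_succ : ∀ i, frame (i + 1) 2 = 𝒯.perm (tet i) (frame i 3) (frame i 3)

namespace NormalCurve

variable {𝒯} (γ : 𝒯.NormalCurve)

/-- A realization of a normal curve by straight segments without self-intersections.  All sides
of the triangles have length one; `enter i` and `leave i` are the distances of the two end points
of the `i`-th segment from the corner which it cuts off. -/
structure Embedding where
  enter : Fin (γ.len + 1) → ℝ
  leave : Fin (γ.len + 1) → ℝ
  enter_mem : ∀ i, enter i ∈ Set.Ioo (0 : ℝ) 1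
  leave_mem : ∀ i, leave i ∈ Set.Ioo (0 : ℝ) 1
  /-- The end point of a segment is the starting point of the next one. -/
  glue : ∀ i, enter (i + 1) =
    if γ.frame (i + 1) 1 = 𝒯.perm (γ.tet i) (γ.frame i 3) (γ.frame i 1)
    then leave i else 1 - leave i
  /-- Two segments that cut off the same corner of the same triangle are disjoint. -/
  same_corner : ∀ i k, i ≠ k → γ.tet i = γ.tet k → γ.frame i 0 = γ.frame k 0 →
    γ.frame i 1 = γ.frame k 1 →
    let d := fun l f => if f = γ.frame l 2 then enter l else leave l
    (d i (γ.frame i 2) < d k (γ.frame i 2) ∧ d i (γ.frame i 3) < d k (γ.frame i 3)) ∨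
    (d k (γ.frame i 2) < d i (γ.frame i 2) ∧ d k (γ.frame i 3) < d i (γ.frame i 3))
  /-- Two segments that cut off different corners of the same triangle are disjoint: they do not
  cross on or near the side which joins these corners. -/
  other_corner : ∀ i k, γ.tet i = γ.tet k → γ.frame i 0 = γ.frame k 0 →
    γ.frame i 1 ≠ γ.frame k 1 → ∀ f, f ≠ γ.frame i 0 → f ≠ γ.frame i 1 → f ≠ γ.frame k 1 →
    let d := fun l f => if f = γ.frame l 2 then enter l else leave l
    d i f + d k f < 1

/-- The value of a cocycle of the boundary surface on a curve. -/
def linkEval (β : 𝒯.LinkCocycle) : ℤ := ∑ i, β.val (γ.tet i) (γ.frame i 0) (γ.frame i 3)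

/-- The value `α(γ)` of the homomorphism `α : π₁(M) → ℤ` on a curve. -/
def eval (α : 𝒯.Cocycle) : ℤ := ∑ i, α.val (γ.tet i) (γ.frame i 3)

/-- Peripheral curves: oriented simple closed curves in the peripheral torus which are
homotopically non-trivial.  (The fundamental group of a torus is free abelian, so a closed curve
is homotopically non-trivial if and only if some homomorphism to `ℤ` does not vanish on it.) -/
structure IsPeripheral : Prop where
  simple : Nonempty γ.Embedding
  essential : ∃ β : 𝒯.LinkCocycle, γ.linkEval β ≠ 0

open Classical in
/-- The entries of the completeness equation of a curve: the arcs around corners with parameter of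
type `q` of `Δ_j` are counted with the sign that tells on which side of the curve the corner is
(it is the parity of `frame i`). -/
def row (q : Fin 3) (j : ι) : ℤ :=
  ∑ i, if γ.tet i = j ∧ quad (γ.frame i 0) (γ.frame i 1) = q
    then (Equiv.Perm.sign (γ.frame i) : ℤ) else 0

end NormalCurve

end Gluing

/-- The three shape parameters `z`, `z' = 1/(1-z)`, `z'' = 1 - 1/z`. -/
def shape (z : ℂ) : Fin 3 → ℂ := ![z, 1 / (1 - z), 1 - 1 / z]

/-- The logarithmic derivatives `ζ`, `ζ'`, `ζ''` of the three shape parameters. -/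
def zeta (z : ℂ) : Fin 3 → ℂ := ![1 / z, 1 / (1 - z), 1 / (z * (z - 1))]

section Invariants

variable {N : ℕ} (𝒯 : Gluing (Fin N))

/-- `z` solves the gluing equations of all edges and the completeness equations of all peripheral
curves, in exponential form. -/
structure IsCompleteSolution (z : Fin N → ℂ) : Prop where
  ne_zero : ∀ j, z j ≠ 0
  ne_one : ∀ j, z j ≠ 1
  edge_eq : ∀ E : 𝒯.Edge, ∏ j, ∏ q, shape (z j) q ^ 𝒯.incidence E j q = 1
  complete : ∀ γ : 𝒯.NormalCurve, γ.IsPeripheral → ∏ j, ∏ q, shape (z j) q ^ γ.row q j = 1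

/-- Combinatorial flattenings `(f, f', f'') = (f 0, f 1, f 2)`. -/
structure IsFlattening (f : Fin 3 → Fin N → ℤ) : Prop where
  edge_eq : ∀ E : 𝒯.Edge, ∑ j, ∑ q, (𝒯.incidence E j q : ℤ) * f q j = 2
  tet_eq : ∀ j, ∑ q, f q j = 1
  peripheral : ∀ γ : 𝒯.NormalCurve, γ.IsPeripheral → ∑ j, ∑ q, γ.row q j * f q j = 0

variable {𝒯}

/-- The gluing equation matrices `G`, `G'`, `G''`, for an ordering `e` of the edges. -/
def G (e : Fin N ≃ 𝒯.Edge) (q : Fin 3) : Matrix (Fin N) (Fin N) ℤ :=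
  Matrix.of fun i j => (𝒯.incidence (e i) j q : ℤ)

/-- The matrices `Ĝ`, `Ĝ'`, `Ĝ''`: the row `r` of `G`, `G'`, `G''` is replaced by the row of the
curve `γ`. -/
def Ghat (e : Fin N ≃ 𝒯.Edge) (r : Fin N) (γ : 𝒯.NormalCurve) (q : Fin 3) :
    Matrix (Fin N) (Fin N) ℤ :=
  (G e q).updateRow r (γ.row q)

/-- The twisted gluing equation matrices `G(t)`, `G'(t)`, `G''(t)`, for a choice of lifts of the
edges to the infinite cyclic cover. -/
def Gt (α : 𝒯.Cocycle) (lift : Fin N → (Gluing.cover α).Edge) (q : Fin 3) :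
    Matrix (Fin N) (Fin N) ℤ[T;T⁻¹] :=
  Matrix.of fun i j => ∑ᶠ k : ℤ,
    LaurentPolynomial.C ((Gluing.cover α).incidence (lift i) (k, j) q : ℤ) * LaurentPolynomial.T k

/-- The denominator `∏ ζ^f ζ'^f' ζ''^f''`. -/
def flatFactor (z : Fin N → ℂ) (f : Fin 3 → Fin N → ℤ) : ℂ := ∏ j, ∏ q, zeta (z j) q ^ f q j

/-- The 1-loop invariant with respect to the curve `γ`, for given choices:
`det (Â diag(ζ) + B̂ diag(ζ'')) / (2 ∏ ζ^f ζ'^f' ζ''^f'')`. -/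
def oneLoop (e : Fin N ≃ 𝒯.Edge) (r : Fin N) (γ : 𝒯.NormalCurve) (z : Fin N → ℂ)
    (f : Fin 3 → Fin N → ℤ) : ℂ :=
  let A : Matrix (Fin N) (Fin N) ℤ := Ghat e r γ 0 - Ghat e r γ 1
  let B : Matrix (Fin N) (Fin N) ℤ := Ghat e r γ 2 - Ghat e r γ 1
  (A.map (Int.cast : ℤ → ℂ) * Matrix.diagonal (fun j => zeta (z j) 0) +
    B.map (Int.cast : ℤ → ℂ) * Matrix.diagonal (fun j => zeta (z j) 2)).det /
    (2 * flatFactor z f)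

/-- The inclusion of `ℤ[t^±1]` in `ℂ[t^±1]`. -/
def toComplex : ℤ[T;T⁻¹] →+* ℂ[T;T⁻¹] :=
  AddMonoidAlgebra.mapRingHom ℤ (Int.castRingHom ℂ)

/-- The twisted 1-loop invariant, for given choices:
`det (A(t) diag(ζ) + B(t) diag(ζ'')) / ∏ ζ^f ζ'^f' ζ''^f''`. -/
def twistedOneLoop (α : 𝒯.Cocycle) (lift : Fin N → (Gluing.cover α).Edge) (z : Fin N → ℂ)
    (f : Fin 3 → Fin N → ℤ) : ℂ[T;T⁻¹] :=
  let A : Matrix (Fin N) (Fin N) ℤ[T;T⁻¹] := Gt α lift 0 - Gt α lift 1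
  let B : Matrix (Fin N) (Fin N) ℤ[T;T⁻¹] := Gt α lift 2 - Gt α lift 1
  LaurentPolynomial.C (flatFactor z f)⁻¹ *
    (A.map toComplex * Matrix.diagonal (fun j => LaurentPolynomial.C (zeta (z j) 0)) +
      B.map toComplex * Matrix.diagonal (fun j => LaurentPolynomial.C (zeta (z j) 2))).det

end Invariants

/-- Equality in `ℂ[t^±1] / (± t^ℤ)`. -/
def EqUpToUnit (p q : ℂ[T;T⁻¹]) : Prop :=
  ∃ (ε : ℤˣ) (r : ℤ), p = LaurentPolynomial.C ((ε : ℤ) : ℂ) * LaurentPolynomial.T r * q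

/-- The value of a Laurent polynomial at `t`. -/
def value (p : ℂ[T;T⁻¹]) (t : ℂ) : ℂ := p.coeff.sum fun k a => a * t ^ k

end TwistedNZ

end

/-!
Since `ζ + ζ' + ζ'' = 0`, the matrix `A(t) diag(ζ) + B(t) diag(ζ'')` is
`W(t) = G(t) diag(ζ) + G'(t) diag(ζ') + G''(t) diag(ζ'')`. An edge `c` of the tetrahedron `Δ_j`
contributes `ζ_j^□ t ^ k(c)` to the row of the edge of the triangulation to which it belongs, where
`k(c)` is the exponent of the translate of the lift of `Δ_j` that meets the lift of that edge
(`Gluing.exists_exponent`). At `t = 1` the sum of all rows of `W` vanishes, as the three types of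
edges occur equally often in a tetrahedron. Replacing a row of `W` by the sum of all rows does not
change the determinant; hence `det W(1) = 0`, and the derivative of `det W` at `1` is the
determinant of `W(1)` with a row replaced by the sum of `k(c) ζ(c)` over the edges `c` of the
tetrahedra (`hasDerivAt_det_twistedMatrix`). Each edge gives two corners of the boundary torus, one
at each end, so this row is half the sum of `k(c) ζ(c)` over all corners. The row of the
completeness equation of `λ` is the sum of `C(c) ζ(c)` over all corners, where `C(c)` is the signed
number of arcs of `λ` around the corner `c`. The determinant with a row replaced by such a sum vanishes for
functions of the triangles of the torus, by `ζ + ζ' + ζ'' = 0`, and for functions of its vertices,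
since these become functions of the edges of the triangulation when symmetrized with respect to the
exchange of the two ends of an edge (`rowDet_cornerVec_eq_zero`). Therefore everything follows from
`C = ± k + (function of the vertices) + (function of the triangles)`,
which is `IsOneCusped.exists_sign`.

This identity says that, up to sign, the class of `λ` in the first homology group of the torus is
the one dual to `α`. Call a function of the corners closed if its differences along the sides of the
triangles form a flow; both `C` and `k` are closed. As the torus has `6 N` sides, the closed
functions have dimension at most `6 N + 1` (`finrank_ker_sideDefect_le`), while the sums of a
function of the `2 N` vertices and a function of the `4 N` triangles have dimension at least
`6 N - 1` (`IsOneCusped.finrank_vertexAddTriangle`).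
The pairing with `α` (`LinkCocycle.pairing`) vanishes on these sums, on `k`, and on `C` because
`α(λ) = 0`, but not on the corner count of `μ`; and `k` is not such a sum as its jumps along `μ` add
up to `α(μ) = 1`. Thus `C` is a rational multiple `m k` up to such sums
(`IsOneCusped.exists_multiple`), and `m` is an integer, being the sum of the jumps of `C` along `μ`.
If `m` were not `± 1`, then `λ` would be null-homologous modulo `m`; as it is a simple closed curve,
it would be null-homologous over `ℤ` (`Gluing.NormalCurve.Embedding.isVertexAddTriangle_int`) and no
cocycle could detect it, in contradiction to its being essential.
-/

open scoped Matrix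

noncomputable section

namespace TwistedNZ

open Equiv

/-! ### Frames and corners -/

variable {ι : Type}

instance [Finite ι] : Finite (Corner ι) :=
  Finite.of_injective (fun c => (c.tet, c.v, c.w)) fun c d h => by
    simp only [Prod.mk.injEq] at h
    exact Corner.ext h.1 h.2.1 h.2.2

instance [Finite ι] : Fintype (Corner ι) := Fintype.ofFinite _

/-- The corner `π 1` of the triangle `(j, π 0)`, for a frame `(j, π)`. -/
def frameCorner (x : ι × Perm (Fin 4)) : Corner ι :=
  ⟨x.1, x.2 0, x.2 1, x.2.injective.ne (by decide)⟩

/-- Frames `(j, π)` with `π` even.  Each corner `(j, v, w)` has exactly one even frame with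
`π 0 = v`, `π 1 = w`, so that the even frames are the corners of the boundary triangles, equipped
with the permutations of a combinatorial map. -/
abbrev EvenFrame (ι : Type) := {x : ι × Perm (Fin 4) // Perm.sign x.2 = 1}

/-- The corner of an even frame. -/
def EvenFrame.corner (x : EvenFrame ι) : Corner ι := frameCorner x.1

lemma perm_eq_of_zero_one (π σ : Perm (Fin 4)) (h0 : σ 0 = π 0) (h1 : σ 1 = π 1) :
    σ = π ∨ σ = π * swap 2 3 := by
  have key : ∀ G : Perm (Fin 4), G 0 = 0 → G 1 = 1 → G = 1 ∨ G = swap 2 3 := by decide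
  rcases key (π⁻¹ * σ) (by simp [h0]) (by simp [h1]) with h | h
  · left; rw [inv_mul_eq_one] at h; exact h.symm
  · right; rw [← h, mul_inv_cancel_left]

lemma exists_perm_zero_one (v w : Fin 4) (h : v ≠ w) :
    ∃ π : Perm (Fin 4), Perm.sign π = 1 ∧ π 0 = v ∧ π 1 = w := by
  revert v w; decide

lemma EvenFrame.corner_bijective : Function.Bijective (EvenFrame.corner (ι := ι)) := by
  constructor
  · rintro ⟨⟨j, π⟩, hπ⟩ ⟨⟨k, σ⟩, hσ⟩ h
    simp only [EvenFrame.corner, frameCorner, Corner.mk.injEq] at h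
    obtain ⟨rfl, h0, h1⟩ := h
    rcases perm_eq_of_zero_one π σ h0.symm h1.symm with rfl | rfl
    · rfl
    · simp only at hπ hσ
      rw [Perm.sign_mul, hπ, Perm.sign_swap (by decide)] at hσ
      exact absurd hσ (by decide)
  · rintro ⟨j, v, w, h⟩
    obtain ⟨π, h1, rfl, rfl⟩ := exists_perm_zero_one v w h
    exact ⟨⟨(j, π), h1⟩, rfl⟩

lemma card_evenFrame [Fintype ι] : Fintype.card (EvenFrame ι) = 12 * Fintype.card ι := by
  classical
  have e : EvenFrame ι ≃ ι × {π : Perm (Fin 4) // Perm.sign π = 1} :=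
    { toFun := fun x => (x.1.1, ⟨x.1.2, x.2⟩)
      invFun := fun x => ⟨(x.1, x.2.1), x.2.2⟩
      left_inv := fun x => rfl
      right_inv := fun x => rfl }
  rw [Fintype.card_congr e, Fintype.card_prod, mul_comm]
  congr 1

/-- Turn to the next corner of the same triangle. -/
def EvenFrame.turn : Perm (EvenFrame ι) where
  toFun x := ⟨(x.1.1, x.1.2 * (swap 1 2 * swap 2 3)), by
    rw [Perm.sign_mul, x.2]; decide⟩
  invFun x := ⟨(x.1.1, x.1.2 * (swap 2 3 * swap 1 2)), by
    rw [Perm.sign_mul, x.2]; decide⟩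
  left_inv x := by
    ext1; ext1
    · rfl
    · simp only [mul_assoc]
      rw [show (swap 1 2 * (swap 2 3 * (swap 2 3 * swap 1 2)) : Perm (Fin 4)) = 1 by decide,
        mul_one]
  right_inv x := by
    ext1; ext1
    · rfl
    · simp only [mul_assoc]
      rw [show (swap 2 3 * (swap 1 2 * (swap 1 2 * swap 2 3)) : Perm (Fin 4)) = 1 by decide,
        mul_one]

namespace Gluing

variable (𝒯 : Gluing ι)

/-- Cross the side `π 3` of the triangle, keeping the names of its two ends. -/
def crossFrame (x : ι × Perm (Fin 4)) : ι × Perm (Fin 4) :=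
  (𝒯.nbr x.1 (x.2 3), 𝒯.perm x.1 (x.2 3) * x.2)

lemma crossFrame_crossFrame (x : ι × Perm (Fin 4)) : 𝒯.crossFrame (𝒯.crossFrame x) = x := by
  obtain ⟨j, π⟩ := x
  simp [crossFrame, 𝒯.nbr_nbr, 𝒯.perm_perm]

/-- Cross the side `π 3` of the triangle, exchanging the names of its two ends. -/
def flip : Perm (EvenFrame ι) :=
  Function.Involutive.toPerm
    (fun x => ⟨(𝒯.nbr x.1.1 (x.1.2 3), 𝒯.perm x.1.1 (x.1.2 3) * x.1.2 * swap 1 2), by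
      rw [Perm.sign_mul, Perm.sign_mul, x.2, 𝒯.odd]; decide⟩)
    (by
      rintro ⟨⟨j, π⟩, hπ⟩
      have h3 : (swap 1 2 : Perm (Fin 4)) 3 = 3 := by decide
      ext1
      simp [Perm.mul_apply, h3, 𝒯.nbr_nbr, 𝒯.perm_perm, mul_assoc])

lemma flip_flip (x : EvenFrame ι) : 𝒯.flip (𝒯.flip x) = x :=
  Function.Involutive.toPerm_involutive _ x

lemma flip_val (x : EvenFrame ι) : (𝒯.flip x).1 =
    (𝒯.nbr x.1.1 (x.1.2 3), 𝒯.perm x.1.1 (x.1.2 3) * x.1.2 * swap 1 2) := rfl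

lemma flip_ne (x : EvenFrame ι) : 𝒯.flip x ≠ x := by
  intro h
  have h' := congrArg Subtype.val h
  rw [flip_val, Prod.ext_iff] at h'
  refine 𝒯.ne_self x.1.1 (x.1.2 3) ⟨h'.1, ?_⟩
  have := congrArg (fun p : Perm (Fin 4) => p 3) h'.2
  simpa [Perm.mul_apply, show (swap 1 2 : Perm (Fin 4)) 3 = 3 by decide] using this

lemma turn_flip (x : EvenFrame ι) : (EvenFrame.turn (𝒯.flip x)).1 = 𝒯.rot x.1 := by
  simp only [EvenFrame.turn, coe_fn_mk, flip_val, rot]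
  rw [mul_assoc, show (swap 1 2 * (swap 1 2 * swap 2 3) : Perm (Fin 4)) = swap 2 3 by decide]

lemma corner_turn_flip (x : EvenFrame ι) :
    (EvenFrame.turn (𝒯.flip x)).corner = 𝒯.cross (x.1.2 3) x.corner := by
  rw [EvenFrame.corner, turn_flip]
  have h0 : (swap 2 3 : Perm (Fin 4)) 0 = 0 := by decide
  have h1 : (swap 2 3 : Perm (Fin 4)) 1 = 1 := by decide
  simp [frameCorner, rot, cross, EvenFrame.corner, Perm.mul_apply, h0, h1]

/-! ### Sums over cycles and the pairing with a cocycle of the boundary -/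

/-- If the sum of `a` along every closed cycle of a permutation `ρ` of a finite set vanishes, then
so does the total sum of `a` weighted by any `ρ`-invariant function. -/
lemma sum_mul_eq_zero_of_cycle_sums {A : Type*} [Fintype A] (ρ : Perm A) (a w : A → ℚ)
    (ha : ∀ x n, ρ^[n] x = x → ∑ i ∈ Finset.range n, a (ρ^[i] x) = 0)
    (hw : ∀ x, w (ρ x) = w x) : ∑ x, w x * a x = 0 := by
  classical
  have hM : 0 < orderOf ρ := orderOf_pos ρ
  have hw' : ∀ i x, w (ρ^[i] x) = w x := by
    intro i
    induction i with
    | zero => intro x; rfl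
    | succ i ih => intro x; rw [Function.iterate_succ_apply, ih, hw]
  have h1 : ∀ i, ∑ x, w x * a x = ∑ x, w x * a (ρ^[i] x) := by
    intro i
    rw [← Equiv.sum_comp (ρ ^ i) (fun x => w x * a x)]
    refine Finset.sum_congr rfl fun x _ => ?_
    rw [Equiv.Perm.coe_pow, hw']
  have h2 : (orderOf ρ : ℚ) * ∑ x, w x * a x = 0 := by
    calc (orderOf ρ : ℚ) * ∑ x, w x * a x
        = ∑ i ∈ Finset.range (orderOf ρ), ∑ x, w x * a (ρ^[i] x) := by
          rw [← Finset.sum_congr rfl fun i _ => h1 i]; simp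
      _ = ∑ x, w x * ∑ i ∈ Finset.range (orderOf ρ), a (ρ^[i] x) := by
          rw [Finset.sum_comm]; simp [Finset.mul_sum]
      _ = 0 := by
          refine Finset.sum_eq_zero fun x _ => ?_
          rw [ha x _ (by rw [← Equiv.Perm.coe_pow, pow_orderOf_eq_one]; rfl), mul_zero]
  have h3 : (orderOf ρ : ℚ) ≠ 0 := by exact_mod_cast hM.ne'
  exact (mul_eq_zero.mp h2).resolve_left h3

/-- The restriction to the boundary of a cocycle of the manifold. -/
def Cocycle.toLink {𝒯 : Gluing ι} (α : 𝒯.Cocycle) : 𝒯.LinkCocycle where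
  val j _ f := α.val j f
  anti j _ f _ := α.anti j f
  closed := α.closed

variable {𝒯}

lemma NormalCurve.linkEval_toLink (γ : 𝒯.NormalCurve) (α : 𝒯.Cocycle) :
    γ.linkEval α.toLink = γ.eval α := rfl

/-- The pairing of a cocycle `β` of the boundary with a function `C` on the corners of the boundary
triangles.  If `C` is the corner count of a closed curve, it is twice the value of `β` on the
curve. -/
def LinkCocycle.pairing [Fintype ι] (β : 𝒯.LinkCocycle) : (EvenFrame ι → ℚ) →ₗ[ℚ] ℚ :=
  ∑ x : EvenFrame ι, ((β.val x.1.1 (x.1.2 0) (x.1.2 3) - β.val x.1.1 (x.1.2 0) (x.1.2 2) : ℤ) : ℚ) •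
    LinearMap.proj x

section Pairing

variable [Fintype ι]

lemma LinkCocycle.pairing_apply (β : 𝒯.LinkCocycle) (C : EvenFrame ι → ℚ) :
    β.pairing C = ∑ x : EvenFrame ι,
      ((β.val x.1.1 (x.1.2 0) (x.1.2 3) : ℚ) - β.val x.1.1 (x.1.2 0) (x.1.2 2)) * C x := by
  simp [LinkCocycle.pairing, LinearMap.sum_apply]

/-- The pairing vanishes on functions of the vertices of the boundary. -/
lemma LinkCocycle.pairing_of_rot_invariant (β : 𝒯.LinkCocycle) (C : EvenFrame ι → ℚ)
    (hC : ∀ x, C (EvenFrame.turn (𝒯.flip x)) = C x) : β.pairing C = 0 := by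
  set ρ : Perm (EvenFrame ι) := 𝒯.flip.trans EvenFrame.turn with hρ
  have hρv : ∀ x, (ρ x).1 = 𝒯.rot x.1 := turn_flip 𝒯
  have hit : ∀ i x, (ρ^[i] x).1 = 𝒯.rot^[i] x.1 := by
    intro i
    induction i with
    | zero => intro x; rfl
    | succ i ih => intro x; rw [Function.iterate_succ_apply, Function.iterate_succ_apply, ih, hρv]
  have h1 : ∑ x : EvenFrame ι, C x * (β.val x.1.1 (x.1.2 0) (x.1.2 3) : ℚ) = 0 := by
    refine sum_mul_eq_zero_of_cycle_sums ρ _ C (fun x n hn => ?_) hC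
    have := β.closed x.1 n (by rw [← hit, hn])
    simp only [hit]
    exact_mod_cast this
  have h2 : ∑ x : EvenFrame ι, C x * (β.val x.1.1 (x.1.2 0) (x.1.2 2) : ℚ) = 0 := by
    rw [← Equiv.sum_comp ρ, ← neg_eq_zero, ← Finset.sum_neg_distrib, ← h1]
    refine Finset.sum_congr rfl fun x _ => ?_
    have := β.anti x.1.1 (x.1.2 0) (x.1.2 3) (x.1.2.injective.ne (by decide))
    rw [show C (ρ x) = C x from hC x, hρv, rot]
    simp only [Perm.mul_apply, show (swap 2 3 : Perm (Fin 4)) 0 = 0 by decide,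
      show (swap 2 3 : Perm (Fin 4)) 2 = 3 by decide, this]
    push_cast; ring
  rw [pairing_apply]
  simp only [sub_mul, Finset.sum_sub_distrib]
  simp only [mul_comm _ (C _)]
  rw [h1, h2, sub_zero]

/-- The pairing vanishes on functions of the triangles of the boundary. -/
lemma LinkCocycle.pairing_of_turn_invariant (β : 𝒯.LinkCocycle) (C : EvenFrame ι → ℚ)
    (hC : ∀ x, C (EvenFrame.turn x) = C x) : β.pairing C = 0 := by
  rw [pairing_apply]
  simp only [sub_mul, Finset.sum_sub_distrib]
  rw [sub_eq_zero, ← Equiv.sum_comp (EvenFrame.turn (ι := ι))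
    (fun x : EvenFrame ι => (β.val x.1.1 (x.1.2 0) (x.1.2 2) : ℚ) * C x)]
  refine Finset.sum_congr rfl fun x _ => ?_
  rw [hC x]
  simp only [EvenFrame.turn, coe_fn_mk, Perm.mul_apply,
    show (swap 1 2 : Perm (Fin 4)) ((swap 2 3 : Perm (Fin 4)) 0) = 0 by decide,
    show (swap 1 2 : Perm (Fin 4)) ((swap 2 3 : Perm (Fin 4)) 2) = 3 by decide]

/-- The pairing with a cocycle that extends to the manifold vanishes on functions of the edges of
the tetrahedra: the two ends of an edge contribute with opposite signs. -/
lemma Cocycle.pairing_of_rev_invariant (α : 𝒯.Cocycle) (C : Corner ι → ℚ)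
    (hC : ∀ c, C c.rev = C c) : α.toLink.pairing (fun x => C x.corner) = 0 := by
  let s : Perm (EvenFrame ι) := Function.Involutive.toPerm
    (fun x => ⟨(x.1.1, x.1.2 * (swap 0 1 * swap 2 3)), by rw [Perm.sign_mul, x.2]; decide⟩)
    (by
      intro x
      ext1
      simp only [mul_assoc]
      rw [show (swap 0 1 * (swap 2 3 * (swap 0 1 * swap 2 3)) : Perm (Fin 4)) = 1 by decide,
        mul_one])
  have hs : ∀ x, (s x).1 = (x.1.1, x.1.2 * (swap 0 1 * swap 2 3)) := fun x => rfl
  rw [LinkCocycle.pairing_apply]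
  have h : ∑ x : EvenFrame ι, ((α.toLink.val x.1.1 (x.1.2 0) (x.1.2 3) : ℚ)
      - α.toLink.val x.1.1 (x.1.2 0) (x.1.2 2)) * C x.corner
      = - ∑ x : EvenFrame ι, ((α.toLink.val x.1.1 (x.1.2 0) (x.1.2 3) : ℚ)
      - α.toLink.val x.1.1 (x.1.2 0) (x.1.2 2)) * C x.corner := by
    conv_lhs => rw [← Equiv.sum_comp s]
    rw [← Finset.sum_neg_distrib]
    refine Finset.sum_congr rfl fun x _ => ?_
    have h1 : (s x).corner = x.corner.rev := by
      simp [hs, EvenFrame.corner, frameCorner, Corner.rev, Perm.mul_apply,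
        show (swap 2 3 : Perm (Fin 4)) 0 = 0 by decide,
        show (swap 2 3 : Perm (Fin 4)) 1 = 1 by decide]
    rw [h1, hC]
    simp only [Cocycle.toLink, hs, Perm.mul_apply,
      show (swap 0 1 : Perm (Fin 4)) ((swap 2 3 : Perm (Fin 4)) 3) = 2 by decide,
      show (swap 0 1 : Perm (Fin 4)) ((swap 2 3 : Perm (Fin 4)) 2) = 3 by decide]
    ring
  linarith

end Pairing

/-! ### The corner count of a curve -/

namespace NormalCurve

variable (γ : 𝒯.NormalCurve)

/-- The corner cut off by the `i`-th arc of a curve. -/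
def corner (i : Fin (γ.len + 1)) : Corner ι := frameCorner (γ.tet i, γ.frame i)

/-- The sign of the `i`-th arc of a curve: the side of the curve on which the corner lies. -/
def arcSign (i : Fin (γ.len + 1)) : ℤ := (Perm.sign (γ.frame i) : ℤ)

open Classical in
/-- The signed number of arcs of a curve that cut off a given corner. -/
def cornerCount (c : Corner ι) : ℤ := ∑ i, if γ.corner i = c then γ.arcSign i else 0

end NormalCurve

end Gluing

/-! ### Arcs of a curve and sides of triangles -/

namespace Gluing

namespace NormalCurve

variable {𝒯 : Gluing ι} (γ : 𝒯.NormalCurve)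

lemma frame_succ (i : Fin (γ.len + 1)) :
    (γ.frame (i + 1) 1 = 𝒯.perm (γ.tet i) (γ.frame i 3) (γ.frame i 1) ∧
      γ.frame (i + 1) = 𝒯.perm (γ.tet i) (γ.frame i 3) * γ.frame i * swap 2 3) ∨
    (γ.frame (i + 1) 1 ≠ 𝒯.perm (γ.tet i) (γ.frame i 3) (γ.frame i 1) ∧
      γ.frame (i + 1) = 𝒯.perm (γ.tet i) (γ.frame i 3) * γ.frame i * (swap 1 2 * swap 2 3)) := by
  have key : ∀ G : Perm (Fin 4), G 0 = 0 → G 2 = 2 →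
      (G 1 = 1 ∧ G = 1) ∨ (G 1 ≠ 1 ∧ G = swap 1 3) := by decide
  set ρ := 𝒯.perm (γ.tet i) (γ.frame i 3) * γ.frame i * swap 2 3 with hρ
  have h0 : ρ 0 = γ.frame (i + 1) 0 := by
    rw [γ.vertex_succ]; simp [hρ, Perm.mul_apply, show (swap 2 3 : Perm (Fin 4)) 0 = 0 by decide]
  have h2 : ρ 2 = γ.frame (i + 1) 2 := by
    rw [γ.enter_succ]; simp [hρ, Perm.mul_apply]
  have h1 : ρ 1 = 𝒯.perm (γ.tet i) (γ.frame i 3) (γ.frame i 1) := by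
    simp [hρ, Perm.mul_apply, show (swap 2 3 : Perm (Fin 4)) 1 = 1 by decide]
  rw [← h1]
  rcases key (ρ⁻¹ * γ.frame (i + 1)) (by simp [← h0]) (by simp [← h2]) with ⟨h, h'⟩ | ⟨h, h'⟩
  · left
    rw [inv_mul_eq_one] at h'
    exact ⟨by rw [h'], h'.symm⟩
  · right
    refine ⟨fun hh => h (by simp [hh]), ?_⟩
    rw [inv_mul_eq_iff_eq_mul] at h'
    rw [h', hρ, mul_assoc]
    congr 1
    decide

open Classical in
/-- The number of times a curve leaves a triangle through a given side. -/
def leaveCount (j : ι) (v f : Fin 4) : ℤ :=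
  ∑ i, if γ.tet i = j ∧ γ.frame i 0 = v ∧ γ.frame i 3 = f then 1 else 0

open Classical in
/-- The number of times a curve enters a triangle through a given side. -/
def enterCount (j : ι) (v f : Fin 4) : ℤ :=
  ∑ i, if γ.tet i = j ∧ γ.frame i 0 = v ∧ γ.frame i 2 = f then 1 else 0

/-- The arc after the `i`-th one enters through the other face of a side if and only if the `i`-th
arc leaves through that side. -/
lemma enter_succ_iff (j : ι) (v f : Fin 4) (i : Fin (γ.len + 1)) :
    (γ.tet (i + 1) = 𝒯.nbr j f ∧ γ.frame (i + 1) 0 = 𝒯.perm j f v ∧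
      γ.frame (i + 1) 2 = 𝒯.perm j f f) ↔
    (γ.tet i = j ∧ γ.frame i 0 = v ∧ γ.frame i 3 = f) := by
  rw [γ.tet_succ, γ.vertex_succ, γ.enter_succ]
  constructor
  · rintro ⟨h1, h2, h3⟩
    have hj : γ.tet i = j := by
      rw [← 𝒯.nbr_nbr (γ.tet i) (γ.frame i 3), h1, h3, 𝒯.nbr_nbr]
    have hp : 𝒯.perm (γ.tet i) (γ.frame i 3) = 𝒯.perm j f := by
      rw [← inv_inj, ← 𝒯.perm_perm, ← 𝒯.perm_perm, h1, h3]
    rw [hp] at h2 h3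
    exact ⟨hj, (𝒯.perm j f).injective h2, (𝒯.perm j f).injective h3⟩
  · rintro ⟨rfl, rfl, rfl⟩
    exact ⟨rfl, rfl, rfl⟩

lemma sum_succ {M : Type*} [AddCommMonoid M] (a : Fin (γ.len + 1) → M) :
    ∑ i, a (i + 1) = ∑ i, a i :=
  Equiv.sum_comp (Equiv.addRight (1 : Fin (γ.len + 1))) a

lemma enterCount_cross (j : ι) (v f : Fin 4) :
    γ.enterCount (𝒯.nbr j f) (𝒯.perm j f v) (𝒯.perm j f f) = γ.leaveCount j v f := by
  classical
  rw [enterCount, ← γ.sum_succ]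
  simp only [enter_succ_iff, leaveCount]

lemma leaveCount_cross (j : ι) (v f : Fin 4) :
    γ.leaveCount (𝒯.nbr j f) (𝒯.perm j f v) (𝒯.perm j f f) = γ.enterCount j v f := by
  rw [← enterCount_cross]
  simp [𝒯.nbr_nbr, 𝒯.perm_perm]

/-- The algebraic number of times a curve leaves a triangle through a side is, up to orientation,
the difference of the corner counts at the two ends of the side. -/
lemma cornerCount_sub (j : ι) (π : Perm (Fin 4)) :
    γ.cornerCount (frameCorner (j, π)) - γ.cornerCount (frameCorner (j, π * swap 1 2)) =
      (Perm.sign π : ℤ) * (γ.leaveCount j (π 0) (π 3) - γ.enterCount j (π 0) (π 3)) := by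
  classical
  have key : ∀ G : Perm (Fin 4), G 0 = 0 →
      (if G 1 = 1 then (Perm.sign G : ℤ) else 0) - (if G 1 = 2 then (Perm.sign G : ℤ) else 0) =
      (if G 3 = 3 then 1 else 0) - (if G 2 = 3 then 1 else 0) := by decide
  simp only [cornerCount, leaveCount, enterCount, ← Finset.sum_sub_distrib, Finset.mul_sum]
  refine Finset.sum_congr rfl fun i _ => ?_
  simp only [corner, frameCorner, Corner.mk.injEq, Perm.mul_apply, arcSign,
    show (swap 1 2 : Perm (Fin 4)) 0 = 0 by decide, swap_apply_left]
  by_cases hj : γ.tet i = j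
  swap
  · simp [hj]
  by_cases h0 : γ.frame i 0 = π 0
  swap
  · simp [h0]
  have hk := key (π⁻¹ * γ.frame i) (by simp [h0])
  simp only [Perm.mul_apply, Perm.inv_eq_iff_eq, Perm.sign_mul, Perm.sign_inv] at hk
  have hs : (Perm.sign π : ℤ) * (Perm.sign π : ℤ) = 1 := by
    rw [← Units.val_mul, Int.units_mul_self, Units.val_one]
  simp only [hj, h0, true_and]
  rw [← hk, mul_sub]
  push_cast
  simp only [mul_ite, mul_zero, ← mul_assoc, hs, one_mul]

end NormalCurve

lemma EvenFrame.corner_turn (x : EvenFrame ι) :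
    (EvenFrame.turn x).corner = frameCorner (x.1.1, x.1.2 * swap 1 2) := by
  simp [EvenFrame.turn, EvenFrame.corner, frameCorner, Perm.mul_apply,
    show (swap 2 3 : Perm (Fin 4)) 0 = 0 by decide, show (swap 2 3 : Perm (Fin 4)) 1 = 1 by decide]

lemma corner_flip (𝒯 : Gluing ι) (x : EvenFrame ι) :
    (𝒯.flip x).corner = 𝒯.cross (x.1.2 3) (EvenFrame.turn x).corner := by
  rw [EvenFrame.corner_turn]
  simp [EvenFrame.corner, frameCorner, flip_val, cross, Perm.mul_apply]

/-! ### The space of closed corner functions -/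

/-- For functions `C` on the corners: the sum, over the two triangles at a side, of the differences
of the values of `C` at the ends of this side.  The kernel consists of the functions whose
differences form a closed flow through the sides. -/
def sideDefect {A : Type*} (ρ σ : Perm A) : (A → ℚ) →ₗ[ℚ] (A → ℚ) where
  toFun C x := (C x - C (ρ x)) + (C (σ x) - C (ρ (σ x)))
  map_add' C D := by ext x; simp only [Pi.add_apply]; ring
  map_smul' a C := by ext x; simp only [Pi.smul_apply, smul_eq_mul, RingHom.id_apply]; ring

/-- The transpose of `sideDefect`. -/
def sideDefectTranspose {A : Type*} (ρ σ : Perm A) : (A → ℚ) →ₗ[ℚ] (A → ℚ) where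
  toFun φ x := (φ x + φ (σ x)) - (φ (ρ.symm x) + φ (σ (ρ.symm x)))
  map_add' C D := by ext x; simp only [Pi.add_apply]; ring
  map_smul' a C := by ext x; simp only [Pi.smul_apply, smul_eq_mul, RingHom.id_apply]; ring

lemma finrank_ker_sideDefect_eq {A : Type*} [Fintype A] [DecidableEq A] (ρ σ : Perm A)
    (hσ : ∀ x, σ (σ x) = x) :
    Module.finrank ℚ (LinearMap.ker (sideDefect ρ σ)) =
      Module.finrank ℚ (LinearMap.ker (sideDefectTranspose ρ σ)) := by
  have hσ' : σ.symm = σ := by ext x; rw [Equiv.symm_apply_eq, hσ]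
  have hT : sideDefectTranspose ρ σ = Matrix.toLin' (LinearMap.toMatrix' (sideDefect ρ σ))ᵀ := by
    refine LinearMap.ext fun φ => funext fun y => ?_
    rw [Matrix.toLin'_apply, Matrix.mulVec, dotProduct]
    have h1 : ∀ (τ : Perm A) (x : A), (Pi.single y (1 : ℚ) : A → ℚ) (τ x) =
        if x = τ.symm y then 1 else 0 := by
      intro τ x
      rw [Pi.single_apply]
      simp only [Equiv.eq_symm_apply]
    have h2 : ∀ x : A, (Pi.single y (1 : ℚ) : A → ℚ) x = if x = y then 1 else 0 := by
      intro x; rw [Pi.single_apply]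
    have h3 : ∀ x : A, (Pi.single y (1 : ℚ) : A → ℚ) (ρ (σ x)) =
        if x = σ (ρ.symm y) then 1 else 0 := by
      intro x
      rw [h1]
      exact if_congr ⟨fun h => by rw [← h, hσ], fun h => by rw [h, hσ]⟩ rfl rfl
    have h4 : ∀ x : A, (LinearMap.toMatrix' (sideDefect ρ σ))ᵀ y x * φ x =
        ((if x = y then φ x else 0) - if x = ρ.symm y then φ x else 0) +
        ((if x = σ y then φ x else 0) - if x = σ (ρ.symm y) then φ x else 0) := by
      intro x
      rw [Matrix.transpose_apply, LinearMap.toMatrix'_apply]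
      simp only [sideDefect, LinearMap.coe_mk, AddHom.coe_mk]
      rw [h3, h1 ρ, h1 σ, h2, hσ']
      simp only [add_mul, sub_mul, ite_mul, one_mul, zero_mul]
    simp only [h4, Finset.sum_add_distrib, Finset.sum_sub_distrib, Finset.sum_ite_eq',
      Finset.mem_univ, if_true, sideDefectTranspose, LinearMap.coe_mk,
      AddHom.coe_mk]
    ring
  have h1 := LinearMap.finrank_range_add_finrank_ker (sideDefect ρ σ)
  have h2 := LinearMap.finrank_range_add_finrank_ker (sideDefectTranspose ρ σ)
  have h3 : Module.finrank ℚ (LinearMap.range (sideDefect ρ σ)) =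
      Module.finrank ℚ (LinearMap.range (sideDefectTranspose ρ σ)) := by
    have := Matrix.rank_transpose (LinearMap.toMatrix' (sideDefect ρ σ))
    rw [Matrix.rank, Matrix.rank, ← Matrix.toLin'_apply', ← Matrix.toLin'_apply', ← hT,
      Matrix.toLin'_toMatrix'] at this
    exact this.symm
  omega

/-- In a connected combinatorial map with free edge involution `σ`, the closed corner functions form
a space of dimension at most one more than the number of edges. -/
lemma finrank_ker_sideDefect_le {A : Type*} [Fintype A] [DecidableEq A] (ρ σ : Perm A)
    (hσ : ∀ x, σ (σ x) = x) (hfree : ∀ x, σ x ≠ x) (a₀ : A)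
    (hconn : ∀ φ : A → ℚ, (∀ x, φ (σ x) = φ x) → (∀ x, φ (ρ x) = φ x) → ∀ x y, φ x = φ y) :
    2 * Module.finrank ℚ (LinearMap.ker (sideDefect ρ σ)) ≤ Fintype.card A + 2 := by
  rw [finrank_ker_sideDefect_eq ρ σ hσ]
  -- choose one element from each `σ`-orbit by means of a linear order
  let key := Fintype.equivFin A
  let A' := {x : A // key x < key (σ x)}
  have hcard : 2 * Fintype.card A' = Fintype.card A := by
    have e : A' ≃ {x : A // ¬ key x < key (σ x)} :=
      { toFun := fun x => ⟨σ x.1, by rw [hσ]; exact not_lt.mpr x.2.le⟩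
        invFun := fun x => ⟨σ x.1, by
          rw [hσ]
          exact lt_of_le_of_ne (not_lt.mp x.2) (fun h => hfree x.1 (key.injective h))⟩
        left_inv := fun x => Subtype.ext (hσ _)
        right_inv := fun x => Subtype.ext (hσ _) }
    have h1 := Fintype.card_congr e
    have h2 := Fintype.card_subtype_compl (fun x : A => key x < key (σ x))
    have h3 := Fintype.card_subtype_le (fun x : A => key x < key (σ x))
    simp only [A'] at h1 ⊢
    omega
  let F : LinearMap.ker (sideDefectTranspose ρ σ) →ₗ[ℚ] (A' → ℚ) × ℚ :=
    { toFun := fun φ => (fun x => φ.1 x.1, φ.1 a₀ + φ.1 (σ a₀))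
      map_add' := fun φ ψ => by
        ext1
        · rfl
        · simp only [Submodule.coe_add, Pi.add_apply, Prod.snd_add]; ring
      map_smul' := fun a φ => by
        ext1
        · rfl
        · simp only [Submodule.coe_smul, Pi.smul_apply, smul_eq_mul, RingHom.id_apply,
            Prod.smul_snd]; ring }
  have hF : Function.Injective F := by
    rw [injective_iff_map_eq_zero]
    rintro ⟨φ, hφ⟩ h
    rw [Prod.ext_iff] at h
    have h1 : ∀ x : A', φ x.1 = 0 := fun x => congrFun h.1 x
    have h2 : φ a₀ + φ (σ a₀) = 0 := h.2
    have h3 : ∀ x, φ x + φ (σ x) = 0 := by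
      intro x
      rw [← h2]
      refine hconn (fun x => φ x + φ (σ x)) (fun x => ?_) (fun x => ?_) x a₀
      · simp only [hσ]; ring
      · have := congrFun (LinearMap.mem_ker.mp hφ) (ρ x)
        simp only [sideDefectTranspose, LinearMap.coe_mk, AddHom.coe_mk, symm_apply_apply,
          Pi.zero_apply] at this
        linarith
    ext x
    simp only [ZeroMemClass.coe_zero, Pi.zero_apply]
    by_cases hx : key x < key (σ x)
    · exact h1 ⟨x, hx⟩
    · have h4 := h1 ⟨σ x, by
        rw [hσ]
        exact lt_of_le_of_ne (not_lt.mp hx) (fun h => hfree x (key.injective h))⟩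
      have h5 := h3 x
      simp only at h4
      linarith
  have := LinearMap.finrank_le_finrank_of_injective hF
  rw [Module.finrank_prod, Module.finrank_fintype_fun_eq_card, Module.finrank_self] at this
  omega

end Gluing

/-! ### Curves and potentials as closed corner functions -/

namespace Gluing

variable {𝒯 : Gluing ι}

lemma turn_tet (x : EvenFrame ι) : (EvenFrame.turn x).1.1 = x.1.1 := rfl

lemma turn_vertex (x : EvenFrame ι) : (EvenFrame.turn x).1.2 0 = x.1.2 0 := by
  simp [EvenFrame.turn, Perm.mul_apply, show (swap 2 3 : Perm (Fin 4)) 0 = 0 by decide,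
    show (swap 1 2 : Perm (Fin 4)) 0 = 0 by decide]

lemma cornerCount_mem_ker (γ : 𝒯.NormalCurve) :
    (fun x : EvenFrame ι => (γ.cornerCount x.corner : ℚ)) ∈
      LinearMap.ker (sideDefect EvenFrame.turn 𝒯.flip) := by
  rw [LinearMap.mem_ker]
  funext x
  have h : ∀ y : EvenFrame ι, γ.cornerCount y.corner - γ.cornerCount (EvenFrame.turn y).corner =
      γ.leaveCount y.1.1 (y.1.2 0) (y.1.2 3) - γ.enterCount y.1.1 (y.1.2 0) (y.1.2 3) := by
    intro y
    rw [EvenFrame.corner_turn, EvenFrame.corner, γ.cornerCount_sub, y.2]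
    simp
  have h1 := h x
  have h2 := h (𝒯.flip x)
  rw [flip_val] at h2
  simp only [Perm.mul_apply, show (swap 1 2 : Perm (Fin 4)) 0 = 0 by decide,
    show (swap 1 2 : Perm (Fin 4)) 3 = 3 by decide, γ.leaveCount_cross, γ.enterCount_cross] at h2
  simp only [sideDefect, LinearMap.coe_mk, AddHom.coe_mk, Pi.zero_apply]
  have h3 : (γ.cornerCount x.corner - γ.cornerCount (EvenFrame.turn x).corner) +
    (γ.cornerCount (𝒯.flip x).corner - γ.cornerCount (EvenFrame.turn (𝒯.flip x)).corner) = 0 := by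
    rw [h1, h2]; ring
  exact_mod_cast h3

/-- A corner function that changes by a fixed cocycle of the triangles when a side is crossed is
closed. -/
lemma mem_ker_of_cross (a : ι → Fin 4 → Fin 4 → ℚ) (k : Corner ι → ℚ)
    (hk : ∀ c f, f ≠ c.v → f ≠ c.w → k (𝒯.cross f c) = k c + a c.tet c.v f) :
    (fun x : EvenFrame ι => k x.corner) ∈
      LinearMap.ker (sideDefect EvenFrame.turn 𝒯.flip) := by
  rw [LinearMap.mem_ker]
  funext x
  simp only [sideDefect, LinearMap.coe_mk, AddHom.coe_mk, Pi.zero_apply]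
  rw [corner_turn_flip, corner_flip, hk, hk]
  · simp only [EvenFrame.corner, frameCorner, turn_tet, turn_vertex]
    ring
  · exact x.1.2.injective.ne (by decide)
  · exact x.1.2.injective.ne (by decide)
  · rw [EvenFrame.corner_turn]; exact x.1.2.injective.ne (by decide)
  · rw [EvenFrame.corner_turn]; exact x.1.2.injective.ne (by decide)

lemma LinkCocycle.pairing_cornerCount [Fintype ι] (β : 𝒯.LinkCocycle) (γ : 𝒯.NormalCurve) :
    β.pairing (fun x => (γ.cornerCount x.corner : ℚ)) = 2 * γ.linkEval β := by
  classical
  have harc : ∀ i, ∃ y : EvenFrame ι, y.corner = γ.corner i ∧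
      (γ.arcSign i : ℚ) * ((β.val y.1.1 (y.1.2 0) (y.1.2 3) : ℚ) -
        β.val y.1.1 (y.1.2 0) (y.1.2 2)) =
      β.val (γ.tet i) (γ.frame i 0) (γ.frame i 3) -
        β.val (γ.tet i) (γ.frame i 0) (γ.frame i 2) := by
    intro i
    rcases Int.units_eq_one_or (Perm.sign (γ.frame i)) with h | h
    · exact ⟨⟨(γ.tet i, γ.frame i), h⟩, rfl, by simp [NormalCurve.arcSign, h]⟩
    · refine ⟨⟨(γ.tet i, γ.frame i * swap 2 3), by
        rw [Perm.sign_mul, h]; decide⟩, ?_, ?_⟩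
      · simp [EvenFrame.corner, NormalCurve.corner, frameCorner, Perm.mul_apply,
          show (swap 2 3 : Perm (Fin 4)) 0 = 0 by decide,
          show (swap 2 3 : Perm (Fin 4)) 1 = 1 by decide]
      · simp [NormalCurve.arcSign, h, Perm.mul_apply,
          show (swap 2 3 : Perm (Fin 4)) 0 = 0 by decide]
  choose y hy1 hy2 using harc
  have h1 : ∀ i, (β.val (γ.tet (i + 1)) (γ.frame (i + 1) 0) (γ.frame (i + 1) 2) : ℚ) =
      - β.val (γ.tet i) (γ.frame i 0) (γ.frame i 3) := by
    intro i
    rw [γ.tet_succ, γ.vertex_succ, γ.enter_succ,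
      β.anti _ _ _ ((γ.frame i).injective.ne (by decide))]
    push_cast; rfl
  rw [pairing_apply]
  simp only [NormalCurve.cornerCount, Int.cast_sum, Finset.mul_sum]
  rw [Finset.sum_comm]
  have h2 : ∀ i, ∑ x : EvenFrame ι, ((β.val x.1.1 (x.1.2 0) (x.1.2 3) : ℚ) -
      β.val x.1.1 (x.1.2 0) (x.1.2 2)) *
      ((if γ.corner i = x.corner then γ.arcSign i else 0 : ℤ) : ℚ) =
      β.val (γ.tet i) (γ.frame i 0) (γ.frame i 3) -
        β.val (γ.tet i) (γ.frame i 0) (γ.frame i 2) := by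
    intro i
    rw [Finset.sum_eq_single (y i)]
    · rw [if_pos (hy1 i).symm, mul_comm, hy2]
    · intro x _ hx
      rw [if_neg, Int.cast_zero, mul_zero]
      rw [← hy1 i]
      exact fun h => hx (EvenFrame.corner_bijective.1 h).symm
    · simp
  rw [Finset.sum_congr rfl fun i _ => h2 i, Finset.sum_sub_distrib,
    ← γ.sum_succ (fun i => (β.val (γ.tet i) (γ.frame i 0) (γ.frame i 2) : ℚ)),
    Finset.sum_congr rfl fun i _ => h1 i, Finset.sum_neg_distrib, NormalCurve.linkEval]
  push_cast; ring

/-! ### Vertex functions, triangle functions and connectedness -/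

/-- `Φ` is the sum of a function of the vertices of the boundary, namely `u`, and a function of its
triangles. -/
structure IsVertexAddTriangle {R : Type*} [AddGroup R] (𝒯 : Gluing ι) (Φ u : Corner ι → R) :
    Prop where
  vertex : ∀ c f, f ≠ c.v → f ≠ c.w → u (𝒯.cross f c) = u c
  triangle : ∀ c d, c.tet = d.tet → c.v = d.v → Φ c - u c = Φ d - u d

lemma LinkCocycle.pairing_eq_zero [Fintype ι] (β : 𝒯.LinkCocycle) {Φ u : Corner ι → ℚ}
    (h : IsVertexAddTriangle 𝒯 Φ u) : β.pairing (fun x => Φ x.corner) = 0 := by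
  have h1 : β.pairing (fun x => u x.corner) = 0 := by
    refine β.pairing_of_rot_invariant _ fun x => ?_
    rw [corner_turn_flip]
    exact h.vertex _ _ (x.1.2.injective.ne (by decide)) (x.1.2.injective.ne (by decide))
  have h2 : β.pairing (fun x => Φ x.corner - u x.corner) = 0 := by
    refine β.pairing_of_turn_invariant _ fun x => ?_
    rw [EvenFrame.corner_turn]
    refine h.triangle _ _ rfl ?_
    simp [EvenFrame.corner, frameCorner, show (swap 1 2 : Perm (Fin 4)) 0 = 0 by decide]
  have h3 : (fun x : EvenFrame ι => Φ x.corner) =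
      (fun x => u x.corner) + fun x => Φ x.corner - u x.corner := by
    funext x; simp
  rw [h3, map_add, h1, h2, add_zero]

/-- The sum of the jumps of such a function along a closed curve vanishes. -/
lemma IsVertexAddTriangle.sum_jump {R : Type*} [AddCommGroup R] {Φ u : Corner ι → R}
    (h : IsVertexAddTriangle 𝒯 Φ u) (γ : 𝒯.NormalCurve) :
    ∑ i, (Φ (𝒯.cross (γ.frame i 3) (γ.corner i)) - Φ (γ.corner i)) = 0 := by
  have h1 : ∀ i, Φ (𝒯.cross (γ.frame i 3) (γ.corner i)) - Φ (γ.corner i) =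
      (Φ (γ.corner (i + 1)) - u (γ.corner (i + 1))) - (Φ (γ.corner i) - u (γ.corner i)) := by
    intro i
    rw [h.triangle (γ.corner (i + 1)) (𝒯.cross (γ.frame i 3) (γ.corner i)),
      h.vertex]
    · abel
    · exact (γ.frame i).injective.ne (by decide)
    · exact (γ.frame i).injective.ne (by decide)
    · exact γ.tet_succ i
    · exact γ.vertex_succ i
  rw [Finset.sum_congr rfl fun i _ => h1 i, Finset.sum_sub_distrib,
    γ.sum_succ (fun i => Φ (γ.corner i) - u (γ.corner i)), sub_self]

/-- The vertex of the boundary at which a corner lies. -/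
def linkVertex (𝒯 : Gluing ι) (c : Corner ι) : 𝒯.LinkVertex := Quot.mk _ c

lemma linkVertex_cross (c : Corner ι) (f : Fin 4) (hv : f ≠ c.v) (hw : f ≠ c.w) :
    𝒯.linkVertex (𝒯.cross f c) = 𝒯.linkVertex c :=
  (Quot.sound ⟨f, hv, hw, rfl⟩).symm

variable [Fintype ι]

lemma IsOneCusped.forall_triangle (h : 𝒯.IsOneCusped) {P : ι × Fin 4 → Prop} (t₀ : ι × Fin 4)
    (h₀ : P t₀) (hP : ∀ j v f, f ≠ v → P (j, v) → P (𝒯.nbr j f, 𝒯.perm j f v)) (t : ι × Fin 4) :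
    P t := by
  have h1 := h.connected t₀ t
  induction h1 with
  | refl => exact h₀
  | tail _ hst ih =>
    obtain ⟨f, hf, rfl⟩ := hst
    exact hP _ _ f hf ih

lemma IsOneCusped.evenFrame_const (h : 𝒯.IsOneCusped) (φ : EvenFrame ι → ℚ)
    (h1 : ∀ x, φ (𝒯.flip x) = φ x) (h2 : ∀ x, φ (EvenFrame.turn x) = φ x) (x y : EvenFrame ι) :
    φ x = φ y := by
  have hturn : ∀ x y : EvenFrame ι, x.1.1 = y.1.1 → x.1.2 0 = y.1.2 0 → φ x = φ y := by
    rintro ⟨⟨j, π⟩, hπ⟩ ⟨⟨k, σ⟩, hσ⟩ hjk h0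
    simp only at hjk h0 hπ hσ
    subst hjk
    have key : ∀ G : Perm (Fin 4), Perm.sign G = 1 → G 0 = 0 → G = 1 ∨ G = swap 1 2 * swap 2 3 ∨
        G = (swap 1 2 * swap 2 3) * (swap 1 2 * swap 2 3) := by decide
    rcases key (π⁻¹ * σ) (by simp [hπ, hσ]) (by simp [← h0]) with h | h | h <;>
      rw [inv_mul_eq_iff_eq_mul] at h <;> subst h
    · simp
    · exact (h2 _).symm
    · rw [← h2, ← h2 (EvenFrame.turn _)]
      congr 1
  have hP := h.forall_triangle (P := fun t => ∀ y : EvenFrame ι, y.1.1 = t.1 → y.1.2 0 = t.2 →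
    φ y = φ x) (x.1.1, x.1.2 0) (fun y hy1 hy2 => hturn y x hy1 hy2) (by
      intro j v f hf hy y h3 h4
      obtain ⟨π, hπ, h0, hπ3⟩ : ∃ π : Perm (Fin 4), Perm.sign π = 1 ∧ π 0 = v ∧ π 3 = f := by
        clear hy h4 h3
        revert v f; decide
      rw [← hy ⟨(j, π), hπ⟩ rfl h0, ← h1 ⟨(j, π), hπ⟩]
      refine hturn _ _ ?_ ?_
      · rw [h3, flip_val]; simp only [hπ3]
      · rw [h4, flip_val]
        simp [hπ3, h0, show (swap 1 2 : Perm (Fin 4)) 0 = 0 by decide])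
  exact (hP (y.1.1, y.1.2 0) y rfl rfl).symm

/-- The function on the even frames given by a function of the vertices and a function of the
triangles of the boundary. -/
def vertexAddTriangle (𝒯 : Gluing ι) :
    ((𝒯.LinkVertex → ℚ) × (ι × Fin 4 → ℚ)) →ₗ[ℚ] (EvenFrame ι → ℚ) where
  toFun p x := p.1 (𝒯.linkVertex x.corner) + p.2 (x.1.1, x.1.2 0)
  map_add' p q := by ext x; simp only [Prod.fst_add, Prod.snd_add, Pi.add_apply]; ring
  map_smul' a p := by
    ext x
    simp only [Prod.smul_fst, Prod.smul_snd, Pi.smul_apply, smul_eq_mul, RingHom.id_apply]; ring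

lemma IsOneCusped.card_linkVertex (h : 𝒯.IsOneCusped) :
    Nat.card 𝒯.LinkVertex = 2 * Fintype.card ι := by
  have := h.euler
  omega

instance : Finite 𝒯.LinkVertex := inferInstanceAs (Finite (Quot _))

lemma IsOneCusped.finrank_vertexAddTriangle (h : 𝒯.IsOneCusped) :
    6 * Fintype.card ι ≤ Module.finrank ℚ (LinearMap.range 𝒯.vertexAddTriangle) + 1 := by
  have := Fintype.ofFinite 𝒯.LinkVertex
  obtain ⟨j₀⟩ := h.nonempty
  have h1 := LinearMap.finrank_range_add_finrank_ker 𝒯.vertexAddTriangle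
  rw [Module.finrank_prod, Module.finrank_fintype_fun_eq_card, Module.finrank_fintype_fun_eq_card,
    ← Nat.card_eq_fintype_card, h.card_linkVertex, Fintype.card_prod, Fintype.card_fin] at h1
  let F : LinearMap.ker 𝒯.vertexAddTriangle →ₗ[ℚ] ℚ :=
    { toFun := fun p => p.1.2 (j₀, 0)
      map_add' := fun p q => rfl
      map_smul' := fun a p => rfl }
  have hF : Function.Injective F := by
    rw [injective_iff_map_eq_zero]
    rintro ⟨⟨u, g⟩, hp⟩ h0
    have h2 : ∀ c : Corner ι, u (𝒯.linkVertex c) + g (c.tet, c.v) = 0 := by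
      intro c
      obtain ⟨x, rfl⟩ := EvenFrame.corner_bijective.2 c
      exact congrFun (LinearMap.mem_ker.mp hp) x
    have h3 : ∀ t, g t = 0 := by
      refine h.forall_triangle (j₀, 0) h0 fun j v f hf hg => ?_
      obtain ⟨w, hw1, hw2⟩ : ∃ w, v ≠ w ∧ f ≠ w := by
        clear hg; revert v f; decide
      have h4 := h2 ⟨j, v, w, hw1⟩
      have h5 := h2 (𝒯.cross f ⟨j, v, w, hw1⟩)
      rw [linkVertex_cross _ _ hf hw2] at h5
      simp only [cross] at h4 h5
      linarith
    have h4 : u = 0 := by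
      funext q
      obtain ⟨c, rfl⟩ := Quot.exists_rep q
      have := h2 c
      rw [h3, add_zero] at this
      exact this
    have h5 : g = 0 := funext h3
    simp [h4, h5]
  have h2 := LinearMap.finrank_le_finrank_of_injective hF
  rw [Module.finrank_self] at h2
  omega

/-- The first homology of the boundary torus is of rank two, in the following form: a curve `γ` on
which the homomorphism `α` vanishes is rationally homologous to a multiple of the closed flow
dual to `α`, which is given by any potential `k` of `α` on the edges of the tetrahedra. -/
theorem IsOneCusped.exists_multiple (h : 𝒯.IsOneCusped) (α : 𝒯.Cocycle) (μ : 𝒯.NormalCurve)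
    (hμ : μ.eval α = 1) (k : Corner ι → ℤ)
    (hk : ∀ c f, f ≠ c.v → f ≠ c.w → k (𝒯.cross f c) = k c + α.val c.tet f)
    (hrev : ∀ c, k c.rev = k c) (γ : 𝒯.NormalCurve) (hγ : γ.eval α = 0) :
    ∃ (a : ℚ) (u : Corner ι → ℚ),
      IsVertexAddTriangle 𝒯 (fun c => (γ.cornerCount c : ℚ) - a * k c) u := by
  obtain ⟨j₀⟩ := h.nonempty
  let Z : Submodule ℚ (EvenFrame ι → ℚ) := LinearMap.ker (sideDefect EvenFrame.turn 𝒯.flip)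
  let B : Submodule ℚ (EvenFrame ι → ℚ) := LinearMap.range 𝒯.vertexAddTriangle
  let P : Submodule ℚ (EvenFrame ι → ℚ) := LinearMap.ker α.toLink.pairing
  let K : EvenFrame ι → ℚ := fun x => (k x.corner : ℚ)
  have hBdec : ∀ Φ : Corner ι → ℚ, (fun x : EvenFrame ι => Φ x.corner) ∈ B →
      ∃ u, IsVertexAddTriangle 𝒯 Φ u := by
    rintro Φ ⟨⟨u, g⟩, hug⟩
    have h1 : ∀ c : Corner ι, u (𝒯.linkVertex c) + g (c.tet, c.v) = Φ c := by
      intro c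
      obtain ⟨x, rfl⟩ := EvenFrame.corner_bijective.2 c
      exact congrFun hug x
    refine ⟨fun c => u (𝒯.linkVertex c), fun c f hv hw => ?_, fun c d hcd hv => ?_⟩
    · exact congrArg u (linkVertex_cross c f hv hw)
    · rw [← h1, ← h1, hcd, hv]; ring
  -- `B ⊆ Z ⊓ P ⊂ Z` and `K ∈ Z ⊓ P` but `K ∉ B`, where `dim Z ≤ dim B + 2`; so `B` and `K` span
  -- `Z ⊓ P`
  have hdimZ : Module.finrank ℚ Z ≤ 6 * Fintype.card ι + 1 := by
    classical
    have h1 := finrank_ker_sideDefect_le EvenFrame.turn 𝒯.flip 𝒯.flip_flip 𝒯.flip_ne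
      ⟨(j₀, 1), by simp⟩ h.evenFrame_const
    rw [card_evenFrame (ι := ι)] at h1
    change 2 * Module.finrank ℚ Z ≤ _ at h1
    omega
  have hBZ : B ≤ Z ⊓ P := by
    rintro _ ⟨⟨u, g⟩, rfl⟩
    refine ⟨?_, ?_⟩
    · refine LinearMap.mem_ker.mpr (funext fun x => ?_)
      simp only [sideDefect, vertexAddTriangle, LinearMap.coe_mk, AddHom.coe_mk, Pi.zero_apply,
        turn_tet, turn_vertex]
      rw [corner_turn_flip, corner_flip, linkVertex_cross, linkVertex_cross]
      · ring
      all_goals exact x.1.2.injective.ne (by decide)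
    · have h1 : 𝒯.vertexAddTriangle (u, g) = (fun x : EvenFrame ι => u (𝒯.linkVertex x.corner)) +
        fun x => g (x.1.1, x.1.2 0) := rfl
      refine LinearMap.mem_ker.mpr ?_
      rw [h1, map_add, LinkCocycle.pairing_of_rot_invariant,
        LinkCocycle.pairing_of_turn_invariant, add_zero]
      · intro x
        rw [turn_tet, turn_vertex]
      · intro x
        rw [corner_turn_flip, linkVertex_cross]
        · exact x.1.2.injective.ne (by decide)
        · exact x.1.2.injective.ne (by decide)
  have hKZ : K ∈ Z ⊓ P := by
    refine ⟨mem_ker_of_cross (fun j _ f => (α.val j f : ℚ)) (fun c => (k c : ℚ))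
      fun c f hv hw => ?_, ?_⟩
    · rw [hk c f hv hw]; push_cast; rfl
    · exact α.pairing_of_rev_invariant (fun c => (k c : ℚ)) (fun c => by rw [hrev])
  have hKB : K ∉ B := by
    intro hmem
    obtain ⟨u, hu⟩ := hBdec (fun c => (k c : ℚ)) hmem
    have h1 := hu.sum_jump μ
    have h2 : ∀ i, (k (𝒯.cross (μ.frame i 3) (μ.corner i)) : ℚ) - k (μ.corner i) =
        (α.val (μ.tet i) (μ.frame i 3) : ℤ) := by
      intro i
      rw [hk _ _ ((μ.frame i).injective.ne (by decide)) ((μ.frame i).injective.ne (by decide))]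
      push_cast
      rw [add_sub_cancel_left]; rfl
    rw [Finset.sum_congr rfl fun i _ => h2 i, ← Int.cast_sum] at h1
    have h3 : μ.eval α = 0 := by exact_mod_cast h1
    omega
  have hμZ : (fun x : EvenFrame ι => (μ.cornerCount x.corner : ℚ)) ∉ P := by
    intro hmem
    have h1 := LinearMap.mem_ker.mp hmem
    rw [LinkCocycle.pairing_cornerCount, NormalCurve.linkEval_toLink, hμ] at h1
    norm_num at h1
  have hlt : Module.finrank ℚ ↥(Z ⊓ P) < Module.finrank ℚ Z := by
    refine Submodule.finrank_lt_finrank_of_lt (lt_of_le_of_ne inf_le_left fun heq => ?_)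
    have : (fun x : EvenFrame ι => (μ.cornerCount x.corner : ℚ)) ∈ Z ⊓ P := by
      rw [heq]; exact cornerCount_mem_ker μ
    exact hμZ this.2
  have hlt' : Module.finrank ℚ B < Module.finrank ℚ ↥(B ⊔ Submodule.span ℚ {K}) := by
    refine Submodule.finrank_lt_finrank_of_lt (lt_of_le_of_ne le_sup_left fun heq => hKB ?_)
    rw [heq]
    exact Submodule.mem_sup_right (Submodule.mem_span_singleton_self K)
  have hdimB : 6 * Fintype.card ι ≤ Module.finrank ℚ B + 1 := h.finrank_vertexAddTriangle
  have heq : B ⊔ Submodule.span ℚ {K} = Z ⊓ P := by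
    refine Submodule.eq_of_le_of_finrank_le (sup_le hBZ ?_) (by omega)
    rw [Submodule.span_le, Set.singleton_subset_iff]
    exact hKZ
  have hγmem : (fun x : EvenFrame ι => (γ.cornerCount x.corner : ℚ)) ∈
      B ⊔ Submodule.span ℚ {K} := by
    rw [heq]
    refine ⟨cornerCount_mem_ker γ, ?_⟩
    refine LinearMap.mem_ker.mpr ?_
    rw [LinkCocycle.pairing_cornerCount, NormalCurve.linkEval_toLink, hγ]
    norm_num
  obtain ⟨b, hb, y, hy, hby⟩ := Submodule.mem_sup.mp hγmem
  obtain ⟨a, rfl⟩ := Submodule.mem_span_singleton.mp hy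
  refine ⟨a, hBdec _ ?_⟩
  convert hb using 1
  rw [eq_sub_of_add_eq hby]
  rfl

end Gluing

/-! ### Simple closed curves -/

namespace Gluing

variable {𝒯 : Gluing ι}

namespace NormalCurve

variable {γ : 𝒯.NormalCurve} (E : γ.Embedding)

lemma perm_cases_of_zero (π σ : Perm (Fin 4)) (h0 : σ 0 = π 0) (h3 : σ 3 = π 3) :
    σ = π ∨ σ = π * swap 1 2 := by
  have key : ∀ G : Perm (Fin 4), G 0 = 0 → G 3 = 3 → G = 1 ∨ G = swap 1 2 := by decide
  rcases key (π⁻¹ * σ) (by simp [h0]) (by simp [h3]) with h | h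
  · left; rw [inv_mul_eq_one] at h; exact h.symm
  · right; rw [← h, mul_inv_cancel_left]

namespace Embedding

/-- The distance from the corner cut off by the `k`-th arc to its end point on the side `f`. -/
def depth (k : Fin (γ.len + 1)) (f : Fin 4) : ℝ := if f = γ.frame k 2 then E.enter k else E.leave k

lemma depth_enter (k : Fin (γ.len + 1)) : E.depth k (γ.frame k 2) = E.enter k := if_pos rfl

lemma depth_leave (k : Fin (γ.len + 1)) : E.depth k (γ.frame k 3) = E.leave k :=
  if_neg ((γ.frame k).injective.ne (by decide))

lemma depth_lt_iff {i k : Fin (γ.len + 1)} (h : γ.corner k = γ.corner i) :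
    E.depth k (γ.frame i 3) < E.depth i (γ.frame i 3) ↔
      E.depth k (γ.frame i 2) < E.depth i (γ.frame i 2) := by
  by_cases hik : i = k
  · subst hik; simp
  · simp only [corner, frameCorner, Corner.mk.injEq] at h
    rcases E.same_corner i k hik h.1.symm h.2.1.symm h.2.2.symm with ⟨h2, h3⟩ | ⟨h2, h3⟩
    · exact ⟨fun h => absurd h (not_lt.mpr h3.le), fun h => absurd h (not_lt.mpr h2.le)⟩
    · exact ⟨fun _ => h2, fun _ => h3⟩

lemma depth_ne {i k : Fin (γ.len + 1)} (hik : k ≠ i) (h : γ.corner k = γ.corner i) (f : Fin 4)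
    (hf : f = γ.frame i 2 ∨ f = γ.frame i 3) : E.depth k f ≠ E.depth i f := by
  simp only [corner, frameCorner, Corner.mk.injEq] at h
  rcases E.same_corner i k hik.symm h.1.symm h.2.1.symm h.2.2.symm with ⟨h2, h3⟩ | ⟨h2, h3⟩ <;>
    rcases hf with rfl | rfl
  · exact h2.ne'
  · exact h3.ne'
  · exact h2.ne
  · exact h3.ne

open Classical in
/-- The signed number of arcs between the corner cut off by the `i`-th arc and this arc. -/
def innerSum (i : Fin (γ.len + 1)) : ℤ :=
  ∑ k, if γ.corner k = γ.corner i ∧ E.depth k (γ.frame i 3) < E.depth i (γ.frame i 3) then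
    γ.arcSign k else 0

open Classical in
lemma innerSum_eq (i : Fin (γ.len + 1)) (f : Fin 4) (hf : f = γ.frame i 2 ∨ f = γ.frame i 3) :
    E.innerSum i = ∑ k, if γ.corner k = γ.corner i ∧ E.depth k f < E.depth i f then
      γ.arcSign k else 0 := by
  rcases hf with rfl | rfl
  · refine Finset.sum_congr rfl fun k _ => if_congr (and_congr_right fun h => ?_) rfl rfl
    exact E.depth_lt_iff h
  · rfl

open Classical in
/-- The number of times the curve leaves through the side `π 3` of the triangle `(j, π 0)` at
distance less than `t` from its end `π 1`. -/
def leaveBelow (x : ι × Perm (Fin 4)) (t : ℝ) : ℤ :=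
  ∑ k, if (γ.tet k = x.1 ∧ γ.frame k 0 = x.2 0 ∧ γ.frame k 3 = x.2 3) ∧
    (if γ.frame k 1 = x.2 1 then E.leave k else 1 - E.leave k) < t then 1 else 0

open Classical in
/-- The number of times the curve enters through the side `π 3` of the triangle `(j, π 0)` at
distance less than `t` from its end `π 1`. -/
def enterBelow (x : ι × Perm (Fin 4)) (t : ℝ) : ℤ :=
  ∑ k, if (γ.tet k = x.1 ∧ γ.frame k 0 = x.2 0 ∧ γ.frame k 2 = x.2 3) ∧
    (if γ.frame k 1 = x.2 1 then E.enter k else 1 - E.enter k) < t then 1 else 0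

lemma enterBelow_crossFrame (x : ι × Perm (Fin 4)) (t : ℝ) :
    E.enterBelow (𝒯.crossFrame x) t = E.leaveBelow x t := by
  classical
  rw [enterBelow, ← γ.sum_succ]
  refine Finset.sum_congr rfl fun k _ => ?_
  simp only [crossFrame, Perm.mul_apply, enter_succ_iff]
  refine if_congr (and_congr_right fun h => ?_) rfl rfl
  obtain ⟨j, π⟩ := x
  obtain ⟨hj, h0, h3⟩ := h
  simp only at hj h0 h3
  subst hj
  have hglue := E.glue k
  have hframe := γ.frame_succ k
  rw [h3] at hglue hframe
  set p := 𝒯.perm (γ.tet k) (π 3)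
  suffices (if γ.frame (k + 1) 1 = p (π 1) then E.enter (k + 1) else 1 - E.enter (k + 1)) =
      if γ.frame k 1 = π 1 then E.leave k else 1 - E.leave k from
    iff_of_eq (congrArg (· < t) this)
  have hp : γ.frame k 1 = π 1 ∨ γ.frame k 1 = π 2 ∧ γ.frame k 2 = π 1 := by
    rcases perm_cases_of_zero π (γ.frame k) h0 h3 with h | h
    · left; rw [h]
    · right; rw [h]; simp [Perm.mul_apply]
  rcases hframe with ⟨h1, -⟩ | ⟨h1, h2⟩
  · rw [if_pos h1] at hglue
    simp only [h1, hglue, p.injective.eq_iff]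
  · rw [if_neg h1] at hglue
    rcases hp with hp | ⟨hp, hp'⟩
    · rw [hp] at h1
      rw [if_neg h1, if_pos hp, hglue]; ring
    · have h4 : γ.frame (k + 1) 1 = p (π 1) := by
        rw [h2, ← hp']
        simp [Perm.mul_apply, show (swap 2 3 : Perm (Fin 4)) 1 = 1 by decide]
      rw [if_pos h4, if_neg, hglue]
      rw [hp]; exact π.injective.ne (by decide)

lemma leaveBelow_crossFrame (x : ι × Perm (Fin 4)) (t : ℝ) :
    E.leaveBelow (𝒯.crossFrame x) t = E.enterBelow x t := by
  rw [← enterBelow_crossFrame, crossFrame_crossFrame]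

/-- The arcs between a corner and the `i`-th arc are those which meet a side of this corner between
the corner and the `i`-th arc. -/
lemma innerSum_eq_below (i : Fin (γ.len + 1)) (π : Perm (Fin 4)) (h0 : π 0 = γ.frame i 0)
    (h1 : π 1 = γ.frame i 1) :
    E.innerSum i = (Perm.sign π : ℤ) * (E.leaveBelow (γ.tet i, π) (E.depth i (π 3)) -
      E.enterBelow (γ.tet i, π) (E.depth i (π 3))) := by
  classical
  have hπ3 : π 3 = γ.frame i 2 ∨ π 3 = γ.frame i 3 := by
    rcases perm_eq_of_zero_one (γ.frame i) π h0 h1 with h | h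
    · right; rw [h]
    · left; rw [h]; simp [Perm.mul_apply]
  rw [E.innerSum_eq i _ hπ3, leaveBelow, enterBelow, ← Finset.sum_sub_distrib, Finset.mul_sum]
  refine Finset.sum_congr rfl fun k _ => ?_
  by_cases hk : γ.tet k = γ.tet i ∧ γ.frame k 0 = π 0
  swap
  · rw [if_neg, if_neg, if_neg, sub_zero, mul_zero]
    · exact fun h => hk ⟨h.1.1, h.1.2.1⟩
    · exact fun h => hk ⟨h.1.1, h.1.2.1⟩
    · intro h
      have := h.1
      simp only [corner, frameCorner, Corner.mk.injEq] at this
      exact hk ⟨this.1, this.2.1.trans h0.symm⟩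
  obtain ⟨hkj, hk0⟩ := hk
  have hne : ∀ a b : Fin 4, a ≠ b → γ.frame k a ≠ γ.frame k b :=
    fun a b h => (γ.frame k).injective.ne h
  have hneπ : ∀ a b : Fin 4, a ≠ b → π a ≠ π b := fun a b h => π.injective.ne h
  by_cases hk1 : γ.frame k 1 = π 1
  · have hc : γ.corner k = γ.corner i := by
      simp only [corner, frameCorner, Corner.mk.injEq]
      exact ⟨hkj, hk0.trans h0, hk1.trans h1⟩
    simp only [hc, hkj, hk0, hk1, true_and, if_true]
    rcases perm_eq_of_zero_one π (γ.frame k) hk0 hk1 with h | h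
    · have h3 : γ.frame k 3 = π 3 := by rw [h]
      have h2 : γ.frame k 2 ≠ π 3 := by rw [h]; exact hneπ _ _ (by decide)
      have hd : E.depth k (π 3) = E.leave k := by rw [← h3, depth_leave]
      simp only [h3, h2, hd, arcSign, true_and, false_and, if_false, sub_zero, mul_ite, mul_one,
        mul_zero]
      rw [h]
    · have h2 : γ.frame k 2 = π 3 := by rw [h]; simp [Perm.mul_apply]
      have h3 : γ.frame k 3 ≠ π 3 := by rw [← h2]; exact hne _ _ (by decide)
      have hd : E.depth k (π 3) = E.enter k := by rw [← h2, depth_enter]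
      have hs : Perm.sign (γ.frame k) = - Perm.sign π := by
        rw [h, Perm.sign_mul, Perm.sign_swap (by decide), mul_neg_one]
      simp only [h3, h2, hd, arcSign, true_and, false_and, if_false, zero_sub, hs]
      split_ifs <;> simp
  · have hc : γ.corner k ≠ γ.corner i := by
      simp only [corner, frameCorner, ne_eq, Corner.mk.injEq, not_and]
      exact fun _ _ h => hk1 (h.trans h1.symm)
    rw [if_neg (fun h => hc h.1)]
    by_cases hk3 : γ.frame k 1 = π 3
    · rw [if_neg, if_neg, sub_zero, mul_zero]
      · rintro ⟨⟨-, -, h⟩, -⟩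
        exact hne 1 2 (by decide) (hk3.trans h.symm)
      · rintro ⟨⟨-, -, h⟩, -⟩
        exact hne 1 3 (by decide) (hk3.trans h.symm)
    · have hlt : E.depth i (π 3) + E.depth k (π 3) < 1 :=
        E.other_corner i k hkj.symm (h0.symm.trans hk0.symm) (fun h => hk1 (by rw [h1, h])) (π 3)
          (by rw [← h0]; exact hneπ _ _ (by decide)) (by rw [← h1]; exact hneπ _ _ (by decide))
          (Ne.symm hk3)
      rw [if_neg, if_neg, sub_zero, mul_zero]
      · rintro ⟨⟨-, -, h⟩, h'⟩
        simp only at h h'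
        rw [if_neg hk1] at h'
        rw [← h, depth_enter, h] at hlt
        linarith
      · rintro ⟨⟨-, -, h⟩, h'⟩
        simp only at h h'
        rw [if_neg hk1] at h'
        rw [← h, depth_leave, h] at hlt
        linarith

/-- The end points of two different arcs on a common side are different. -/
lemma position_ne (i k : Fin (γ.len + 1)) (f : Fin 4) (hki : k ≠ i) (hj : γ.tet k = γ.tet i)
    (h0 : γ.frame k 0 = γ.frame i 0) (hf : f = γ.frame i 2 ∨ f = γ.frame i 3)
    (hfk : f = γ.frame k 2 ∨ f = γ.frame k 3) :
    (if γ.frame k 1 = γ.frame i 1 then E.depth k f else 1 - E.depth k f) ≠ E.depth i f := by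
  have hne : ∀ l, ∀ a b : Fin 4, a ≠ b → γ.frame l a ≠ γ.frame l b :=
    fun l a b h => (γ.frame l).injective.ne h
  split_ifs with h1
  · refine E.depth_ne hki ?_ f hf
    simp only [corner, frameCorner, Corner.mk.injEq]
    exact ⟨hj, h0, h1⟩
  · have hlt : E.depth i f + E.depth k f < 1 := by
      refine E.other_corner i k hj.symm h0.symm (Ne.symm h1) f ?_ ?_ ?_
      · rcases hf with rfl | rfl <;> exact hne _ _ _ (by decide)
      · rcases hf with rfl | rfl <;> exact hne _ _ _ (by decide)
      · rcases hfk with rfl | rfl <;> exact hne _ _ _ (by decide)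
    intro h
    linarith

lemma leaveBelow_add (i : Fin (γ.len + 1)) :
    E.leaveBelow (γ.tet i, γ.frame i) (E.leave i) +
      E.leaveBelow (γ.tet i, γ.frame i * swap 1 2) (1 - E.leave i) + 1 =
      γ.leaveCount (γ.tet i) (γ.frame i 0) (γ.frame i 3) := by
  classical
  have h1 : (1 : ℤ) = ∑ k, if k = i then 1 else 0 := by simp
  rw [h1, leaveBelow, leaveBelow, leaveCount, ← Finset.sum_add_distrib, ← Finset.sum_add_distrib]
  refine Finset.sum_congr rfl fun k _ => ?_
  simp only [Perm.mul_apply, show (swap 1 2 : Perm (Fin 4)) 0 = 0 by decide,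
    show (swap 1 2 : Perm (Fin 4)) 3 = 3 by decide, swap_apply_left]
  by_cases hk : γ.tet k = γ.tet i ∧ γ.frame k 0 = γ.frame i 0 ∧ γ.frame k 3 = γ.frame i 3
  swap
  · have : k ≠ i := by rintro rfl; exact hk ⟨rfl, rfl, rfl⟩
    simp only [hk, this, false_and, if_false, add_zero]
  by_cases hki : k = i
  · subst hki
    have : γ.frame k 1 ≠ γ.frame k 2 := (γ.frame k).injective.ne (by decide)
    simp [this]
  obtain ⟨hj, h0, h3⟩ := hk
  have hpos := E.position_ne i k (γ.frame i 3) hki hj h0 (Or.inr rfl) (Or.inr h3.symm)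
  rw [depth_leave] at hpos
  rw [← h3, depth_leave] at hpos
  have hsw : (if γ.frame k 1 = γ.frame i 2 then E.leave k else 1 - E.leave k) =
      1 - (if γ.frame k 1 = γ.frame i 1 then E.leave k else 1 - E.leave k) := by
    have h12 : γ.frame i 1 ≠ γ.frame i 2 := (γ.frame i).injective.ne (by decide)
    rcases perm_cases_of_zero (γ.frame i) (γ.frame k) h0 h3 with h | h
    · have : γ.frame k 1 = γ.frame i 1 := by rw [h]
      rw [this, if_neg h12, if_pos rfl]
    · have : γ.frame k 1 = γ.frame i 2 := by rw [h]; simp [Perm.mul_apply]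
      rw [this, if_pos rfl, if_neg h12.symm]; ring
  rw [hsw]
  simp only [hj, h0, h3, true_and, hki, if_false, if_true, add_zero]
  rcases lt_or_gt_of_ne hpos with hlt | hlt
  · rw [if_pos hlt, if_neg (by linarith)]; rfl
  · rw [if_neg (by linarith), if_pos (by linarith)]; rfl

lemma enterBelow_add (i : Fin (γ.len + 1)) :
    E.enterBelow (γ.tet i, γ.frame i) (E.leave i) +
      E.enterBelow (γ.tet i, γ.frame i * swap 1 2) (1 - E.leave i) =
      γ.enterCount (γ.tet i) (γ.frame i 0) (γ.frame i 3) := by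
  classical
  rw [enterBelow, enterBelow, enterCount, ← Finset.sum_add_distrib]
  refine Finset.sum_congr rfl fun k _ => ?_
  simp only [Perm.mul_apply, show (swap 1 2 : Perm (Fin 4)) 0 = 0 by decide,
    show (swap 1 2 : Perm (Fin 4)) 3 = 3 by decide, swap_apply_left]
  by_cases hk : γ.tet k = γ.tet i ∧ γ.frame k 0 = γ.frame i 0 ∧ γ.frame k 2 = γ.frame i 3
  swap
  · simp only [hk, false_and, if_false, add_zero]
  obtain ⟨hj, h0, h3⟩ := hk
  have hki : k ≠ i := by
    rintro rfl
    exact (γ.frame k).injective.ne (show (2 : Fin 4) ≠ 3 by decide) h3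
  have hpos := E.position_ne i k (γ.frame i 3) hki hj h0 (Or.inr rfl) (Or.inl h3.symm)
  rw [depth_leave] at hpos
  rw [← h3, depth_enter] at hpos
  have hsw : (if γ.frame k 1 = γ.frame i 2 then E.enter k else 1 - E.enter k) =
      1 - (if γ.frame k 1 = γ.frame i 1 then E.enter k else 1 - E.enter k) := by
    have h12 : γ.frame i 1 ≠ γ.frame i 2 := (γ.frame i).injective.ne (by decide)
    rcases perm_cases_of_zero (γ.frame i) (γ.frame k * swap 2 3)
      (by simpa [Perm.mul_apply, show (swap 2 3 : Perm (Fin 4)) 0 = 0 by decide] using h0)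
      (by simpa [Perm.mul_apply] using h3) with h | h
    · have : γ.frame k 1 = γ.frame i 1 := by
        rw [← h]; simp [Perm.mul_apply, show (swap 2 3 : Perm (Fin 4)) 1 = 1 by decide]
      rw [this, if_neg h12, if_pos rfl]
    · have : γ.frame k 1 = γ.frame i 2 := by
        have := congrArg (fun p : Perm (Fin 4) => p 1) h
        simpa [Perm.mul_apply, show (swap 2 3 : Perm (Fin 4)) 1 = 1 by decide] using this
      rw [this, if_pos rfl, if_neg h12.symm]; ring
  rw [hsw]
  simp only [hj, h0, h3, true_and, if_true]
  rcases lt_or_gt_of_ne hpos with hlt | hlt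
  · rw [if_pos hlt, if_neg (by linarith)]; rfl
  · rw [if_neg (by linarith), if_pos (by linarith)]; rfl

/-- How the signed number of inner arcs changes along the curve: it stays the same as long as the
curve turns around the same vertex; otherwise the two sides of the curve are exchanged. -/
lemma innerSum_succ (i : Fin (γ.len + 1)) :
    (γ.corner (i + 1) = 𝒯.cross (γ.frame i 3) (γ.corner i) ∧ γ.arcSign (i + 1) = γ.arcSign i ∧
      E.innerSum (i + 1) = E.innerSum i) ∨
    (γ.corner (i + 1) = 𝒯.cross (γ.frame i 3) (frameCorner (γ.tet i, γ.frame i * swap 1 2)) ∧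
      γ.arcSign (i + 1) = - γ.arcSign i ∧
      E.innerSum (i + 1) = E.innerSum i + γ.arcSign i - γ.cornerCount (γ.corner i) +
        γ.cornerCount (frameCorner (γ.tet i, γ.frame i * swap 1 2))) := by
  have hglue := E.glue i
  have hodd := 𝒯.odd (γ.tet i) (γ.frame i 3)
  rcases γ.frame_succ i with ⟨h1, hF⟩ | ⟨h1, hF⟩
  · left
    rw [if_pos h1] at hglue
    refine ⟨?_, ?_, ?_⟩
    · simp only [corner, frameCorner, cross, Corner.mk.injEq]
      exact ⟨γ.tet_succ i, γ.vertex_succ i, h1⟩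
    · rw [arcSign, arcSign, hF, Perm.sign_mul, Perm.sign_mul, hodd, Perm.sign_swap (by decide)]
      simp
    · have hx : γ.frame (i + 1) * swap 2 3 = 𝒯.perm (γ.tet i) (γ.frame i 3) * γ.frame i := by
        rw [hF, mul_assoc, swap_mul_self, mul_one]
      have h3 : (γ.frame (i + 1) * swap 2 3 : Perm (Fin 4)) 3 = γ.frame (i + 1) 2 := by
        simp [Perm.mul_apply]
      have h4 := E.innerSum_eq_below (i + 1) (γ.frame (i + 1) * swap 2 3)
        (by simp [Perm.mul_apply, show (swap 2 3 : Perm (Fin 4)) 0 = 0 by decide])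
        (by simp [Perm.mul_apply, show (swap 2 3 : Perm (Fin 4)) 1 = 1 by decide])
      have h5 : (γ.tet (i + 1), γ.frame (i + 1) * swap 2 3) =
          𝒯.crossFrame (γ.tet i, γ.frame i) := by
        rw [hx, γ.tet_succ]; rfl
      rw [h5, h3, depth_enter, hglue, leaveBelow_crossFrame, enterBelow_crossFrame, hx,
        Perm.sign_mul, hodd] at h4
      rw [h4, E.innerSum_eq_below i (γ.frame i) rfl rfl, depth_leave]
      push_cast; ring
  · right
    rw [if_neg h1] at hglue
    have hx : γ.frame (i + 1) * swap 2 3 =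
        𝒯.perm (γ.tet i) (γ.frame i 3) * (γ.frame i * swap 1 2) := by
      rw [hF]
      simp only [mul_assoc]
      rw [show (swap 2 3 * swap 2 3 : Perm (Fin 4)) = 1 by decide, mul_one]
    refine ⟨?_, ?_, ?_⟩
    · have h2 : γ.frame (i + 1) 1 = 𝒯.perm (γ.tet i) (γ.frame i 3) (γ.frame i 2) := by
        rw [hF]; simp [Perm.mul_apply, show (swap 2 3 : Perm (Fin 4)) 1 = 1 by decide]
      simp only [corner, frameCorner, cross, Corner.mk.injEq, Perm.mul_apply, swap_apply_left,
        show (swap 1 2 : Perm (Fin 4)) 0 = 0 by decide]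
      exact ⟨γ.tet_succ i, γ.vertex_succ i, h2⟩
    · rw [arcSign, arcSign, hF, Perm.sign_mul, Perm.sign_mul, hodd,
        show Perm.sign (swap 1 2 * swap 2 3 : Perm (Fin 4)) = 1 by decide]
      simp
    · have h3 : (γ.frame (i + 1) * swap 2 3 : Perm (Fin 4)) 3 = γ.frame (i + 1) 2 := by
        simp [Perm.mul_apply]
      have h4 := E.innerSum_eq_below (i + 1) (γ.frame (i + 1) * swap 2 3)
        (by simp [Perm.mul_apply, show (swap 2 3 : Perm (Fin 4)) 0 = 0 by decide])
        (by simp [Perm.mul_apply, show (swap 2 3 : Perm (Fin 4)) 1 = 1 by decide])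
      have h33 : (γ.frame i * swap 1 2 : Perm (Fin 4)) 3 = γ.frame i 3 := by
        simp [Perm.mul_apply, show (swap 1 2 : Perm (Fin 4)) 3 = 3 by decide]
      have h5 : (γ.tet (i + 1), γ.frame (i + 1) * swap 2 3) =
          𝒯.crossFrame (γ.tet i, γ.frame i * swap 1 2) := by
        rw [hx, γ.tet_succ, crossFrame, h33]
      rw [h5, h3, depth_enter, hglue, leaveBelow_crossFrame, enterBelow_crossFrame, hx,
        Perm.sign_mul, Perm.sign_mul, hodd, Perm.sign_swap (by decide)] at h4
      have h6 := E.leaveBelow_add i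
      have h7 := E.enterBelow_add i
      have h8 := γ.cornerCount_sub (γ.tet i) (γ.frame i)
      have h9 := E.innerSum_eq_below i (γ.frame i) rfl rfl
      rw [depth_leave] at h9
      rw [← h6, ← h7] at h8
      have h10 : γ.corner i = frameCorner (γ.tet i, γ.frame i) := rfl
      rw [h10, h4, h9, arcSign]
      push_cast
      linear_combination h8

end Embedding

/-- Telescoping over a finite set that is linearly ordered by an injective function `r`. -/
lemma sub_eq_sum_of_steps {A M : Type*} [AddCommGroup M] (S : Finset A) (r : A → ℝ)
    (hr : ∀ i ∈ S, ∀ k ∈ S, r i = r k → i = k) (s : A → ℤ) (v : A → M) (φ : M → ℤ) (u : M)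
    (h : ∀ i ∈ S, φ (u - ∑ k ∈ S with r k < r i, v k) -
      φ (u - ∑ k ∈ S with r k < r i, v k - v i) = s i) :
    φ u - φ (u - ∑ k ∈ S, v k) = ∑ k ∈ S, s k := by
  classical
  induction S using Finset.induction_on_max_value r with
  | empty => simp
  | insert a S ha hmax ih =>
    have h1 := ih (fun i hi k hk => hr i (Finset.mem_insert_of_mem hi) k
      (Finset.mem_insert_of_mem hk)) (fun i hi => by
        have h2 := h i (Finset.mem_insert_of_mem hi)
        rwa [Finset.filter_insert, if_neg (not_lt.mpr (hmax i hi))] at h2)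
    have h2 := h a (Finset.mem_insert_self a S)
    have h3 : (insert a S).filter (fun k => r k < r a) = S := by
      ext k
      simp only [Finset.mem_filter, Finset.mem_insert]
      constructor
      · rintro ⟨rfl | hk, hlt⟩
        · exact absurd hlt (lt_irrefl _)
        · exact hk
      · intro hk
        refine ⟨Or.inr hk, lt_of_le_of_ne (hmax k hk) fun heq => ha ?_⟩
        rw [← hr k (Finset.mem_insert_of_mem hk) a (Finset.mem_insert_self a S) heq]
        exact hk
    rw [h3] at h2
    rw [Finset.sum_insert ha, Finset.sum_insert ha, ← h1, ← h2,
      show u - (v a + ∑ k ∈ S, v k) = u - ∑ k ∈ S, v k - v a by abel]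
    ring

/-- If a simple closed curve is null-homologous with coefficients in some nontrivial ring, then it
is null-homologous over `ℤ`. The function `u` gives the heights of the regions of the complement of
the curve, near the vertices, and `u - γ.cornerCount` those in the middle of the triangles. All
regions along one side of the curve have the same height `h`, and all those along the other side
have the height `h - 1 ≠ h`; hence the indicator function of `h` turns the heights in the ring into
integral heights. -/
theorem Embedding.isVertexAddTriangle_int (E : γ.Embedding) {M : Type*} [CommRing M] [Nontrivial M]
    (u : Corner ι → M) (hu : IsVertexAddTriangle 𝒯 (fun c => (γ.cornerCount c : M)) u) :
    ∃ w : Corner ι → ℤ, IsVertexAddTriangle 𝒯 γ.cornerCount w := by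
  classical
  -- `U i` is the height of the region on that side of the `i`-th arc where its corner lies, and
  -- `H i` the height of the region on a fixed side of the curve
  let U : Fin (γ.len + 1) → M := fun i => u (γ.corner i) - (E.innerSum i : M)
  let H : Fin (γ.len + 1) → M := fun i => if γ.arcSign i = 1 then U i else U i + 1
  have hsign : ∀ i, γ.arcSign i = 1 ∨ γ.arcSign i = -1 := by
    intro i
    rcases Int.units_eq_one_or (Perm.sign (γ.frame i)) with h | h <;> simp [arcSign, h]
  have hH : ∀ i, H (i + 1) = H i := by
    intro i
    have hv : ∀ π : Perm (Fin 4), π 3 = γ.frame i 3 →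
        u (𝒯.cross (γ.frame i 3) (frameCorner (γ.tet i, π))) = u (frameCorner (γ.tet i, π)) := by
      intro π hπ
      refine hu.vertex _ _ ?_ ?_ <;> rw [← hπ] <;> exact π.injective.ne (by decide)
    rcases E.innerSum_succ i with ⟨h1, h2, h3⟩ | ⟨h1, h2, h3⟩
    · simp only [H, U, h1, h2, h3]
      rw [show γ.corner i = frameCorner (γ.tet i, γ.frame i) from rfl, hv _ rfl]
    · have h4 := hu.triangle (γ.corner i) (frameCorner (γ.tet i, γ.frame i * swap 1 2)) rfl
        (by simp [corner, frameCorner, show (swap 1 2 : Perm (Fin 4)) 0 = 0 by decide])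
      have h5 := hv (γ.frame i * swap 1 2)
        (by simp [Perm.mul_apply, show (swap 1 2 : Perm (Fin 4)) 3 = 3 by decide])
      simp only [H, U, h1, h2, h3, h5]
      rcases hsign i with hs | hs <;> simp only [hs] <;> norm_num <;>
        linear_combination h4
  have hconst : ∀ i, H i = H 0 := by
    intro i
    induction i using Fin.induction with
    | zero => rfl
    | succ i ih => rw [← ih, ← Fin.coeSucc_eq_succ, hH]
  let φ : M → ℤ := fun m => if m = H 0 then 1 else 0
  have hstep : ∀ i, φ (U i) - φ (U i - (γ.arcSign i : M)) = γ.arcSign i := by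
    intro i
    have h1 := hconst i
    rcases hsign i with hs | hs
    · have h2 : U i = H 0 := by rw [← h1]; simp [H, hs]
      simp [φ, hs, h2]
    · have h2 : U i + 1 = H 0 := by rw [← h1]; simp [H, hs]
      have h3 : U i ≠ H 0 := by rw [← h2]; simp
      simp [φ, hs, h2, h3]
  have hmain : ∀ c, φ (u c) - φ (u c - (γ.cornerCount c : M)) = γ.cornerCount c := by
    intro c
    obtain ⟨f, hfv, hfw⟩ : ∃ f, f ≠ c.v ∧ f ≠ c.w := by
      obtain ⟨j, v, w, h⟩ := c
      clear hu hH hconst hstep hsign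
      simp only
      revert v w; decide
    have hside : ∀ i, γ.corner i = c → f = γ.frame i 2 ∨ f = γ.frame i 3 := by
      rintro i rfl
      obtain ⟨a, rfl⟩ := (γ.frame i).surjective f
      have h0 : a ≠ 0 := fun h => hfv (by rw [h]; rfl)
      have h1 : a ≠ 1 := fun h => hfw (by rw [h]; rfl)
      have : a = 2 ∨ a = 3 := by
        clear hfv hfw; revert a; decide
      rcases this with rfl | rfl <;> simp
    have h1 := sub_eq_sum_of_steps (Finset.univ.filter fun i => γ.corner i = c)
      (fun i => E.depth i f) (fun i hi k hk hik => by
        by_contra hne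
        simp only [Finset.mem_filter, Finset.mem_univ, true_and] at hi hk
        exact E.depth_ne (i := k) hne (hi.trans hk.symm) f (hside k hk) hik)
      γ.arcSign (fun i => (γ.arcSign i : M)) φ (u c) (fun i hi => by
        simp only [Finset.mem_filter, Finset.mem_univ, true_and] at hi
        have h2 : ∑ k ∈ (Finset.univ.filter fun i => γ.corner i = c) with
            E.depth k f < E.depth i f, (γ.arcSign k : M) = (E.innerSum i : M) := by
          rw [E.innerSum_eq i f (hside i hi), Finset.filter_filter, Finset.sum_filter]
          push_cast
          simp only [hi]
        rw [h2, ← hi]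
        exact hstep i)
    have h2 : γ.cornerCount c = ∑ i with γ.corner i = c, γ.arcSign i := by
      rw [cornerCount, Finset.sum_filter]
    rw [h2]
    push_cast
    exact h1
  refine ⟨fun c => φ (u c), fun c f hv hw => ?_, fun c d hcd hv => ?_⟩
  · rw [hu.vertex c f hv hw]
  · have h1 := hmain c
    have h2 := hmain d
    have h3 : u c - (γ.cornerCount c : M) = u d - (γ.cornerCount d : M) := by
      have := hu.triangle c d hcd hv
      linear_combination -this
    rw [h3] at h1
    linarith

end NormalCurve

end Gluing

/-! ### The homology class of a simple closed curve -/

namespace Gluing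

variable {𝒯 : Gluing ι}

lemma IsVertexAddTriangle.not_of_essential [Fintype ι] {γ : 𝒯.NormalCurve}
    (h : ∃ β : 𝒯.LinkCocycle, γ.linkEval β ≠ 0) (u : Corner ι → ℚ) :
    ¬ IsVertexAddTriangle 𝒯 (fun c => (γ.cornerCount c : ℚ)) u := by
  obtain ⟨β, hβ⟩ := h
  intro hu
  have h1 := β.pairing_eq_zero hu
  rw [LinkCocycle.pairing_cornerCount] at h1
  apply hβ
  have h2 : (γ.linkEval β : ℚ) = 0 := by linarith
  exact_mod_cast h2

/-- A peripheral curve on which `α` vanishes represents, up to orientation, the class dual to `α`.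
This class is primitive because `α` takes the value `1`, and so is the class of a simple closed
curve. -/
theorem IsOneCusped.exists_sign [Fintype ι] (h : 𝒯.IsOneCusped) (α : 𝒯.Cocycle)
    (μ : 𝒯.NormalCurve) (hμ : μ.eval α = 1) (k : Corner ι → ℤ)
    (hk : ∀ c f, f ≠ c.v → f ≠ c.w → k (𝒯.cross f c) = k c + α.val c.tet f)
    (hrev : ∀ c, k c.rev = k c) (γ : 𝒯.NormalCurve) (hper : γ.IsPeripheral)
    (hγ : γ.eval α = 0) :
    ∃ (ε : ℤˣ) (u : Corner ι → ℚ),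
      IsVertexAddTriangle 𝒯 (fun c => (γ.cornerCount c : ℚ) - ((ε : ℤ) : ℚ) * k c) u := by
  obtain ⟨a, u, hu⟩ := h.exists_multiple α μ hμ k hk hrev γ hγ
  -- the multiple is an integer, namely the sum of the jumps of the corner count along `μ`
  obtain ⟨m, rfl⟩ : ∃ m : ℤ, a = m := by
    refine ⟨∑ i, (γ.cornerCount (𝒯.cross (μ.frame i 3) (μ.corner i)) -
      γ.cornerCount (μ.corner i)), ?_⟩
    have h1 := hu.sum_jump μ
    have h2 : ∀ i, ((γ.cornerCount (𝒯.cross (μ.frame i 3) (μ.corner i)) : ℚ) -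
        a * k (𝒯.cross (μ.frame i 3) (μ.corner i))) -
        (γ.cornerCount (μ.corner i) - a * k (μ.corner i)) =
        ((γ.cornerCount (𝒯.cross (μ.frame i 3) (μ.corner i)) : ℚ) -
          γ.cornerCount (μ.corner i)) - a * (α.val (μ.tet i) (μ.frame i 3) : ℤ) := by
      intro i
      rw [hk _ _ ((μ.frame i).injective.ne (by decide)) ((μ.frame i).injective.ne (by decide)),
        show (μ.corner i).tet = μ.tet i from rfl]
      push_cast; ring
    have h3 : (∑ i, (α.val (μ.tet i) (μ.frame i 3) : ℚ)) = 1 := by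
      rw [← Int.cast_sum]
      exact_mod_cast hμ
    rw [Finset.sum_congr rfl fun i _ => h2 i, Finset.sum_sub_distrib, ← Finset.mul_sum, h3,
      mul_one, sub_eq_zero] at h1
    rw [← h1]
    push_cast; rfl
  by_cases hm : IsUnit m
  · obtain ⟨ε, rfl⟩ := hm
    exact ⟨ε, u, hu⟩
  exfalso
  obtain ⟨E⟩ := hper.simple
  -- after a shift by a constant, the vertex function is integral
  obtain ⟨j₀⟩ := h.nonempty
  let c₀ : Corner ι := ⟨j₀, 0, 1, by decide⟩
  have hint' : ∀ c d : Corner ι, c.tet = d.tet → c.v = d.v → ∃ n : ℤ, u d - u c = n := by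
    intro c d hcd hv
    refine ⟨γ.cornerCount d - m * k d - (γ.cornerCount c - m * k c), ?_⟩
    have := hu.triangle c d hcd hv
    push_cast
    linarith
  have hint : ∀ t : ι × Fin 4, ∀ c : Corner ι, c.tet = t.1 → c.v = t.2 →
      ∃ n : ℤ, u c - u c₀ = n := by
    refine h.forall_triangle (j₀, 0) (fun c hc hv => hint' c₀ c hc.symm hv.symm) ?_
    intro j v f hf hP c hc hv
    obtain ⟨w, hw1, hw2⟩ : ∃ w, v ≠ w ∧ f ≠ w := by
      clear hP hv hc; revert v f; decide
    obtain ⟨n₁, hn₁⟩ := hP ⟨j, v, w, hw1⟩ rfl rfl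
    obtain ⟨n₂, hn₂⟩ := hint' (𝒯.cross f ⟨j, v, w, hw1⟩) c hc.symm hv.symm
    rw [hu.vertex _ _ hf hw2] at hn₂
    exact ⟨n₁ + n₂, by push_cast; linarith⟩
  have hint'' : ∀ c, ∃ n : ℤ, u c - u c₀ = n := fun c => hint (c.tet, c.v) c rfl rfl
  choose w hw using hint''
  -- for `m = 0` this is `ℤ`
  have hn : Nontrivial (ZMod m.natAbs) := by
    rw [ZMod.nontrivial_iff]
    exact fun hm' => hm (Int.isUnit_iff_natAbs_eq.mpr hm')
  obtain ⟨w', hw'⟩ := E.isVertexAddTriangle_int (M := ZMod m.natAbs)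
    (fun c => (w c : ZMod m.natAbs))
    { vertex := fun c f hv hw1 => by
        have h1 := hu.vertex c f hv hw1
        have h2 : (w (𝒯.cross f c) : ℚ) = w c := by rw [← hw, ← hw, h1]
        have h3 : w (𝒯.cross f c) = w c := by exact_mod_cast h2
        simp only [h3]
      triangle := fun c d hcd hv => by
        have h1 := hu.triangle c d hcd hv
        have h2 : ((γ.cornerCount c - m * k c - w c : ℤ) : ℚ) =
            ((γ.cornerCount d - m * k d - w d : ℤ) : ℚ) := by
          push_cast
          rw [← hw, ← hw]
          linarith
        have h3 : γ.cornerCount c - m * k c - w c = γ.cornerCount d - m * k d - w d := by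
          exact_mod_cast h2
        have h4 := congrArg (Int.cast : ℤ → ZMod m.natAbs) h3
        have h5 : (m : ZMod m.natAbs) = 0 := by
          refine (ZMod.intCast_zmod_eq_zero_iff_dvd _ _).mpr ?_
          exact Int.natAbs_dvd.mpr dvd_rfl
        push_cast at h4
        rw [h5] at h4
        simpa using h4 }
  refine IsVertexAddTriangle.not_of_essential hper.essential (fun c => (w' c : ℚ))
    { vertex := fun c f hv hw1 => ?_, triangle := fun c d hcd hv => ?_ }
  · have := hw'.vertex c f hv hw1
    exact_mod_cast this
  · have := hw'.triangle c d hcd hv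
    exact_mod_cast this

/-! ### Lifting edges to the infinite cyclic cover -/

lemma rot_eq_crossFrame (x : ι × Perm (Fin 4)) :
    𝒯.rot x = ((𝒯.crossFrame x).1, (𝒯.crossFrame x).2 * swap 2 3) := rfl

/-- Walking around an edge, as a permutation of the frames. -/
def rotPerm (𝒯 : Gluing ι) : Perm (ι × Perm (Fin 4)) where
  toFun := 𝒯.rot
  invFun x := 𝒯.crossFrame (x.1, x.2 * swap 2 3)
  left_inv x := by
    have h : ((𝒯.rot x).1, (𝒯.rot x).2 * swap 2 3) = 𝒯.crossFrame x := by
      simp [rot, crossFrame, mul_assoc]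
    exact (congrArg 𝒯.crossFrame h).trans (crossFrame_crossFrame 𝒯 x)
  right_inv x := by
    rw [rot_eq_crossFrame, crossFrame_crossFrame]
    simp [mul_assoc]

/-- A function whose sums over the cycles of a permutation vanish is a coboundary: a potential is
obtained by averaging the partial sums. -/
lemma exists_potential {A : Type*} [Finite A] (ρ : Perm A) (a : A → ℤ)
    (ha : ∀ x n, ρ^[n] x = x → ∑ i ∈ Finset.range n, a (ρ^[i] x) = 0) (s : A → A)
    (hs : ∀ x, ρ (s x) = s (ρ x)) (has : ∀ x, a (s x) = a x) :
    ∃ ψ : A → ℚ, (∀ x, ψ (ρ x) = ψ x + a x) ∧ ∀ x, ψ (s x) = ψ x := by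
  set M := orderOf ρ with hM
  have hMpos : (M : ℚ) ≠ 0 := by exact_mod_cast (orderOf_pos ρ).ne'
  let S : ℕ → A → ℤ := fun n x => ∑ i ∈ Finset.range n, a (ρ^[i] x)
  have hS1 : ∀ n x, S n (ρ x) = S (n + 1) x - a x := by
    intro n x
    simp only [S, Finset.sum_range_succ', Function.iterate_succ_apply, Function.iterate_zero, id]
    ring
  have hSM : ∀ x, S M x = 0 := fun x =>
    ha x M (by rw [← Equiv.Perm.coe_pow, hM, pow_orderOf_eq_one]; rfl)
  have hsit : ∀ i x, ρ^[i] (s x) = s (ρ^[i] x) := by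
    intro i
    induction i with
    | zero => intro x; rfl
    | succ i ih => intro x; rw [Function.iterate_succ_apply, hs, ih, Function.iterate_succ_apply]
  refine ⟨fun x => - (∑ n ∈ Finset.range M, (S n x : ℚ)) / M, fun x => ?_, fun x => ?_⟩
  · have h1 : ∑ n ∈ Finset.range M, (S n (ρ x) : ℚ) =
        ∑ n ∈ Finset.range M, (S n x : ℚ) - M * a x := by
      have h2 : ∑ n ∈ Finset.range M, (S (n + 1) x : ℚ) = ∑ n ∈ Finset.range M, (S n x : ℚ) := by
        have h3 := Finset.sum_range_succ (fun n => (S n x : ℚ)) M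
        rw [Finset.sum_range_succ'] at h3
        simpa [hSM, S] using h3
      simp only [hS1]
      push_cast
      rw [Finset.sum_sub_distrib, h2]
      simp
    simp only [h1]
    field_simp
    ring
  · simp only [S, hsit, has]

/-- A cocycle of the manifold has a rational potential on the edges of the tetrahedra. -/
lemma Cocycle.exists_potential [Finite ι] (α : 𝒯.Cocycle) : ∃ θ : Corner ι → ℚ,
    (∀ c f, f ≠ c.v → f ≠ c.w → θ (𝒯.cross f c) = θ c + α.val c.tet f) ∧ ∀ c, θ c.rev = θ c := by
  obtain ⟨ψ, hψ, hψs⟩ := Gluing.exists_potential 𝒯.rotPerm (fun x => α.val x.1 (x.2 3))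
    (fun x n hn => α.closed x n hn) (fun x => (x.1, x.2 * swap 0 1))
    (by
      intro x
      have h3 : (swap 0 1 : Perm (Fin 4)) 3 = 3 := by decide
      simp only [rotPerm, coe_fn_mk, rot, Perm.mul_apply, h3, mul_assoc]
      rw [show (swap 0 1 * swap 2 3 : Perm (Fin 4)) = swap 2 3 * swap 0 1 by decide])
    (by
      intro x
      have h3 : (swap 0 1 : Perm (Fin 4)) 3 = 3 := by decide
      simp [Perm.mul_apply, h3])
  replace hψ : ∀ x, ψ (𝒯.rot x) = ψ x + α.val x.1 (x.2 3) := hψ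
  let Ψ : ι × Perm (Fin 4) → ℚ := fun x => (ψ x + ψ (x.1, x.2 * swap 2 3)) / 2
  have hΨ1 : ∀ x, Ψ (x.1, x.2 * swap 2 3) = Ψ x := by
    intro x
    simp only [Ψ, mul_assoc, swap_mul_self, mul_one]
    ring
  have hΨ2 : ∀ x, Ψ (𝒯.crossFrame x) = Ψ x + α.val x.1 (x.2 3) := by
    intro x
    have h1 := hψ x
    have h2 := hψ (𝒯.crossFrame x)
    rw [rot_eq_crossFrame] at h1
    rw [rot_eq_crossFrame, crossFrame_crossFrame] at h2
    have h3 : α.val (𝒯.crossFrame x).1 ((𝒯.crossFrame x).2 3) = - α.val x.1 (x.2 3) :=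
      α.anti x.1 (x.2 3)
    rw [h3] at h2
    push_cast at h2
    simp only [Ψ]
    linarith
  have hΨ3 : ∀ x, Ψ (x.1, x.2 * swap 0 1) = Ψ x := by
    intro x
    simp only [Ψ]
    have h1 := hψs x
    have h2 := hψs (x.1, x.2 * swap 2 3)
    simp only [mul_assoc] at h1 h2 ⊢
    rw [show (swap 2 3 * swap 0 1 : Perm (Fin 4)) = swap 0 1 * swap 2 3 by decide] at h2
    rw [h1, h2]
  have hex : ∀ c : Corner ι, ∃ x : ι × Perm (Fin 4), frameCorner x = c := fun c => by
    obtain ⟨x, hx⟩ := EvenFrame.corner_bijective.2 c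
    exact ⟨x.1, hx⟩
  choose fr hfr using hex
  have hθ : ∀ x, Ψ (fr (frameCorner x)) = Ψ x := by
    rintro ⟨j, π⟩
    have h1 := hfr (frameCorner (j, π))
    generalize fr (frameCorner (j, π)) = y at h1
    obtain ⟨k, σ⟩ := y
    simp only [frameCorner, Corner.mk.injEq] at h1
    obtain ⟨rfl, h0, h1⟩ := h1
    rcases perm_eq_of_zero_one π σ h0 h1 with rfl | rfl
    · rfl
    · exact hΨ1 (k, π)
  refine ⟨fun c => Ψ (fr c), fun c f hv hw => ?_, fun c => ?_⟩
  · obtain ⟨j, v, w, hvw⟩ := c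
    obtain ⟨π, rfl, rfl, rfl⟩ : ∃ π : Perm (Fin 4), π 0 = v ∧ π 1 = w ∧ π 3 = f := by
      simp only at hv hw
      revert v w f; decide
    have h1 := hθ (j, π)
    have h2 := hθ (𝒯.crossFrame (j, π))
    rw [hΨ2] at h2
    simp only
    rw [show (⟨j, π 0, π 1, hvw⟩ : Corner ι) = frameCorner (j, π) from rfl, h1, ← h2]
    rfl
  · obtain ⟨x, rfl⟩ := (EvenFrame.corner_bijective (ι := ι)).2 c
    have h1 := hθ x.1
    have h2 := hθ (x.1.1, x.1.2 * swap 0 1)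
    simp only [EvenFrame.corner]
    rw [h1, ← hΨ3 x.1, ← h2]
    congr 2

lemma edge_cross (c : Corner ι) (f : Fin 4) (hv : f ≠ c.v) (hw : f ≠ c.w) :
    𝒯.edge (𝒯.cross f c) = 𝒯.edge c :=
  (Quot.sound (r := 𝒯.EdgeStep) (Or.inl ⟨f, hv, hw, rfl⟩)).symm

lemma edge_rev (c : Corner ι) : 𝒯.edge c.rev = 𝒯.edge c :=
  (Quot.sound (r := 𝒯.EdgeStep) (Or.inr rfl)).symm

/-- The edge `c` of the translate by `m` of the chosen lift of a tetrahedron. -/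
def liftCorner (m : ℤ) (c : Corner ι) : Corner (ℤ × ι) := ⟨(m, c.tet), c.v, c.w, c.ne⟩

/-- The infinite cyclic group acts freely on the edges of the cover. -/
lemma eq_of_edge_liftCorner_eq [Finite ι] (α : 𝒯.Cocycle) (c : Corner ι) (m n : ℤ)
    (h : (cover α).edge (liftCorner m c) = (cover α).edge (liftCorner n c)) : m = n := by
  obtain ⟨θ, hθ, hrev⟩ := α.exists_potential
  let Θ : (cover α).Edge → ℚ := Quot.lift (fun d => d.tet.1 - θ d.proj) (by
    rintro c d (⟨f, hv, hw, rfl⟩ | rfl)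
    · have h1 := hθ c.proj f hv hw
      have h2 : ((cover α).cross f c).proj = 𝒯.cross f c.proj := rfl
      rw [h2, h1]
      simp only [cross, cover, Corner.proj]
      push_cast; ring
    · have h2 : c.rev.proj = c.proj.rev := rfl
      rw [h2, hrev]
      rfl)
  have h1 : (m : ℚ) - θ c = n - θ c := congrArg Θ h
  have h2 : (m : ℚ) = n := by linarith
  exact_mod_cast h2

lemma exists_liftCorner (α : 𝒯.Cocycle) (E : (cover α).Edge) (c : Corner ι)
    (h : edgeProj α E = 𝒯.edge c) : ∃ m, (cover α).edge (liftCorner m c) = E := by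
  obtain ⟨d, rfl⟩ := Quot.exists_rep E
  have h1 : Relation.EqvGen 𝒯.EdgeStep d.proj c := Quot.eqvGen_exact h
  have key : ∀ a b : Corner ι, Relation.EqvGen 𝒯.EdgeStep a b →
      (∀ m, ∃ n, (cover α).edge (liftCorner m a) = (cover α).edge (liftCorner n b)) ∧
      (∀ n, ∃ m, (cover α).edge (liftCorner m a) = (cover α).edge (liftCorner n b)) := by
    intro a b hab
    induction hab with
    | rel a b hab =>
      rcases hab with ⟨f, hv, hw, rfl⟩ | rfl
      · have h2 : ∀ m, (cover α).edge (liftCorner m a) =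
            (cover α).edge (liftCorner (m + α.val a.tet f) (𝒯.cross f a)) := fun m =>
          Quot.sound (Or.inl ⟨f, hv, hw, rfl⟩)
        refine ⟨fun m => ⟨_, h2 m⟩, fun n => ⟨n - α.val a.tet f, ?_⟩⟩
        rw [h2, sub_add_cancel]
      · have h2 : ∀ m, (cover α).edge (liftCorner m a) = (cover α).edge (liftCorner m a.rev) :=
          fun m => Quot.sound (Or.inr rfl)
        exact ⟨fun m => ⟨m, h2 m⟩, fun m => ⟨m, h2 m⟩⟩
    | refl a => exact ⟨fun m => ⟨m, rfl⟩, fun m => ⟨m, rfl⟩⟩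
    | symm a b _ ih =>
      refine ⟨fun m => ?_, fun m => ?_⟩
      · obtain ⟨n, hn⟩ := ih.2 m; exact ⟨n, hn.symm⟩
      · obtain ⟨n, hn⟩ := ih.1 m; exact ⟨n, hn.symm⟩
    | trans a b c _ _ ih1 ih2 =>
      refine ⟨fun m => ?_, fun m => ?_⟩
      · obtain ⟨n, hn⟩ := ih1.1 m
        obtain ⟨l, hl⟩ := ih2.1 n
        exact ⟨l, hn.trans hl⟩
      · obtain ⟨n, hn⟩ := ih2.2 m
        obtain ⟨l, hl⟩ := ih1.2 n
        exact ⟨l, hl.trans hn⟩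
  obtain ⟨m, hm⟩ := (key _ _ h1).1 d.tet.1
  exact ⟨m, hm.symm⟩

/-- For each edge `c` of a tetrahedron there is exactly one translate of the lifted tetrahedron for
which `c` belongs to the chosen lift of an edge.  Its exponent `k c` is a potential of `α`. -/
theorem exists_exponent [Finite ι] (α : 𝒯.Cocycle) {J : Type*} (e : J ≃ 𝒯.Edge)
    (lift : J → (cover α).Edge) (hlift : ∀ i, edgeProj α (lift i) = e i) :
    ∃ k : Corner ι → ℤ,
      (∀ i m c, (cover α).edge (liftCorner m c) = lift i ↔ 𝒯.edge c = e i ∧ m = k c) ∧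
      (∀ c f, f ≠ c.v → f ≠ c.w → k (𝒯.cross f c) = k c + α.val c.tet f) ∧
      ∀ c, k c.rev = k c := by
  have hex : ∀ c, ∃ m, (cover α).edge (liftCorner m c) = lift (e.symm (𝒯.edge c)) := fun c =>
    exists_liftCorner α _ c (by rw [hlift, Equiv.apply_symm_apply])
  choose k hk using hex
  refine ⟨k, fun i m c => ⟨fun h => ?_, ?_⟩, fun c f hv hw => ?_, fun c => ?_⟩
  · have h1 : 𝒯.edge c = e i := by rw [← hlift, ← h]; rfl
    refine ⟨h1, eq_of_edge_liftCorner_eq α c _ _ ?_⟩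
    rw [h, hk, h1, Equiv.symm_apply_apply]
  · rintro ⟨h, rfl⟩
    rw [hk, h, Equiv.symm_apply_apply]
  · refine eq_of_edge_liftCorner_eq α (𝒯.cross f c) _ _ ?_
    rw [hk, edge_cross c f hv hw, ← hk]
    exact Quot.sound (Or.inl ⟨f, hv, hw, rfl⟩)
  · refine eq_of_edge_liftCorner_eq α c.rev _ _ ?_
    rw [hk, edge_rev, ← hk]
    exact Quot.sound (Or.inr rfl)

end Gluing

/-! ### Sums over the edges of a tetrahedron -/

/-- The oriented edges of a tetrahedron, as ordered pairs of vertices. -/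
abbrev OrientedEdge := {p : Fin 4 × Fin 4 // p.1 ≠ p.2}

/-- The oriented edges of the tetrahedron `Δ_j`, as corners. -/
def OrientedEdge.corner {ι : Type} (j : ι) (p : OrientedEdge) : Corner ι := ⟨j, p.1.1, p.1.2, p.2⟩

/-- The parameter type of an edge of a tetrahedron. -/
def OrientedEdge.quad (p : OrientedEdge) : Fin 3 := TwistedNZ.quad p.1.1 p.1.2

namespace OrientedEdge

/-- Reversal of the orientation. -/
def rev : Perm OrientedEdge :=
  Function.Involutive.toPerm (fun p => ⟨(p.1.2, p.1.1), p.2.symm⟩) (fun _ => rfl)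

lemma corner_rev {ι : Type} (j : ι) (p : OrientedEdge) : (rev p).corner j = (p.corner j).rev := rfl

lemma quad_rev (p : OrientedEdge) : (rev p).quad = p.quad := by
  revert p; decide

lemma sum_eq_two_mul {R : Type*} [CommRing R] (a : OrientedEdge → R) (ha : ∀ p, a (rev p) = a p) :
    2 * ∑ p, (if p.1.1 < p.1.2 then a p else 0) = ∑ p, a p := by
  have h1 : ∑ p, (if p.1.1 < p.1.2 then a p else 0) =
      ∑ p : OrientedEdge, (if p.1.2 < p.1.1 then a p else 0) := by
    rw [← Equiv.sum_comp rev]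
    refine Finset.sum_congr rfl fun p _ => ?_
    rw [ha]; rfl
  rw [two_mul]
  nth_rewrite 2 [h1]
  rw [← Finset.sum_add_distrib]
  refine Finset.sum_congr rfl fun p _ => ?_
  rcases lt_or_gt_of_ne p.2 with h | h
  · rw [if_pos h, if_neg (not_lt.mpr h.le), add_zero]
  · rw [if_neg (not_lt.mpr h.le), if_pos h, zero_add]

/-- At each vertex of a tetrahedron there is one edge of each of the three types. -/
lemma sum_mul_quad {R : Type*} [CommRing R] (a : Fin 4 → R) (y : Fin 3 → R)
    (hy : ∑ q, y q = 0) : ∑ p : OrientedEdge, a p.1.1 * y p.quad = 0 := by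
  have h1 : ∑ p : OrientedEdge, a p.1.1 * y p.quad =
      ∑ p : Fin 4 × Fin 4, if p.1 ≠ p.2 then a p.1 * y (TwistedNZ.quad p.1 p.2) else 0 := by
    rw [← Finset.sum_filter]
    exact (Finset.sum_subtype _ (fun p => by simp) (fun p : Fin 4 × Fin 4 =>
      a p.1 * y (TwistedNZ.quad p.1 p.2))).symm
  rw [h1, Fintype.sum_prod_type]
  refine Finset.sum_eq_zero fun v _ => ?_
  have h2 : ∑ w, (if v ≠ w then a v * y (TwistedNZ.quad v w) else 0) = a v * ∑ q, y q := by
    rw [Fin.sum_univ_three, Fin.sum_univ_four]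
    fin_cases v <;> simp [TwistedNZ.quad] <;> ring
  rw [h2, hy, mul_zero]

end OrientedEdge

variable {𝒯 : Gluing ι}

open Classical in
lemma Gluing.incidence_eq_sum (𝒯 : Gluing ι) (E : 𝒯.Edge) (j : ι) (q : Fin 3) :
    (𝒯.incidence E j q : ℤ) = ∑ p : OrientedEdge,
      if p.1.1 < p.1.2 then if p.quad = q ∧ 𝒯.edge (p.corner j) = E then 1 else 0 else 0 := by
  have h1 : {c : Corner ι | c.tet = j ∧ c.v < c.w ∧ quad c.v c.w = q ∧ 𝒯.edge c = E} =
      OrientedEdge.corner j '' ↑(Finset.univ.filter fun p : OrientedEdge =>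
        p.1.1 < p.1.2 ∧ p.quad = q ∧ 𝒯.edge (p.corner j) = E) := by
    ext c
    simp only [Set.mem_ofPred_eq, Finset.coe_filter, Finset.mem_univ, true_and, Set.mem_image]
    constructor
    · rintro ⟨rfl, h⟩
      exact ⟨⟨(c.v, c.w), c.ne⟩, h, rfl⟩
    · rintro ⟨p, h, rfl⟩
      exact ⟨rfl, h⟩
  have hinj : Function.Injective (OrientedEdge.corner j) := by
    intro p p' h
    simp only [OrientedEdge.corner, Corner.mk.injEq, true_and] at h
    exact Subtype.ext (Prod.ext h.1 h.2)
  rw [Gluing.incidence, h1, Set.ncard_image_of_injective _ hinj, Set.ncard_coe_finset,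
    Finset.card_filter]
  push_cast
  refine Finset.sum_congr rfl fun p _ => ?_
  rw [ite_and]

/-! ### Weighted sums of corner functions -/

lemma sum_zeta (z : ℂ) (h0 : z ≠ 0) (h1 : z ≠ 1) : ∑ q, zeta z q = 0 := by
  have h2 : 1 - z ≠ 0 := sub_ne_zero.mpr h1.symm
  have h3 : z - 1 ≠ 0 := sub_ne_zero.mpr h1
  rw [Fin.sum_univ_three]
  simp only [zeta, Matrix.cons_val_zero, Matrix.cons_val_one, Matrix.cons_val]
  rw [← neg_sub z 1]
  field_simp
  ring

/-- The vector of the sums of a function of the corners, weighted by the logarithmic derivatives of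
the parameters; for the corner count of a curve it is the row of its completeness equation. -/
def cornerVec (z : ι → ℂ) : (Corner ι → ℂ) →ₗ[ℂ] (ι → ℂ) where
  toFun φ j := ∑ p : OrientedEdge, φ (p.corner j) * zeta (z j) p.quad
  map_add' φ ψ := by
    funext j; simp only [Pi.add_apply, add_mul, Finset.sum_add_distrib]
  map_smul' a φ := by
    funext j
    simp only [Pi.smul_apply, smul_eq_mul, RingHom.id_apply, Finset.mul_sum, mul_assoc]

lemma cornerVec_apply (z : ι → ℂ) (φ : Corner ι → ℂ) (j : ι) :
    cornerVec z φ j = ∑ p : OrientedEdge, φ (p.corner j) * zeta (z j) p.quad := rfl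

lemma cornerVec_rev (z : ι → ℂ) (φ : Corner ι → ℂ) :
    cornerVec z (fun c => φ c.rev) = cornerVec z φ := by
  funext j
  rw [cornerVec_apply, cornerVec_apply, ← Equiv.sum_comp OrientedEdge.rev]
  refine Finset.sum_congr rfl fun p _ => ?_
  rw [OrientedEdge.corner_rev, OrientedEdge.quad_rev]
  rfl

lemma cornerVec_triangle (z : ι → ℂ) (h0 : ∀ j, z j ≠ 0) (h1 : ∀ j, z j ≠ 1) (g : ι → Fin 4 → ℂ) :
    cornerVec z (fun c => g c.tet c.v) = 0 := by
  funext j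
  exact OrientedEdge.sum_mul_quad (g j) _ (sum_zeta _ (h0 j) (h1 j))

lemma cornerVec_cornerCount (z : ι → ℂ) (γ : 𝒯.NormalCurve) (j : ι) :
    cornerVec z (fun c => (γ.cornerCount c : ℂ)) j = ∑ q, (γ.row q j : ℂ) * zeta (z j) q := by
  classical
  rw [cornerVec_apply]
  simp only [Gluing.NormalCurve.cornerCount, Gluing.NormalCurve.row, Int.cast_sum, Finset.sum_mul]
  rw [Finset.sum_comm, Finset.sum_comm (s := (Finset.univ : Finset (Fin 3)))]
  refine Finset.sum_congr rfl fun i _ => ?_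
  by_cases hj : γ.tet i = j
  · have h1 : ∀ p : OrientedEdge, γ.corner i = p.corner j ↔
        p = ⟨(γ.frame i 0, γ.frame i 1), (γ.frame i).injective.ne (by decide)⟩ := by
      intro p
      simp only [Gluing.NormalCurve.corner, frameCorner, OrientedEdge.corner, Corner.mk.injEq, hj,
        true_and, Subtype.ext_iff, Prod.ext_iff]
      exact and_congr eq_comm eq_comm
    simp only [h1, hj, true_and, Int.cast_ite, Int.cast_zero, ite_mul, zero_mul,
      Finset.sum_ite_eq', Finset.sum_ite_eq, Finset.mem_univ, if_true]
    rfl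
  · rw [Finset.sum_eq_zero, Finset.sum_eq_zero]
    · intro q _
      rw [if_neg (fun h => hj h.1), Int.cast_zero, zero_mul]
    · intro p _
      rw [if_neg, Int.cast_zero, zero_mul]
      exact fun h => hj (congrArg Corner.tet h)

section Determinants

variable {N : ℕ} {𝒯 : Gluing (Fin N)}

/-- The rows of the matrix `G diag(ζ) + G' diag(ζ') + G'' diag(ζ'')`. -/
def edgeRow (e : Fin N ≃ 𝒯.Edge) (z : Fin N → ℂ) (i : Fin N) : Fin N → ℂ :=
  fun j => ∑ q, (𝒯.incidence (e i) j q : ℂ) * zeta (z j) q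

open Classical in
lemma two_smul_edgeRow (e : Fin N ≃ 𝒯.Edge) (z : Fin N → ℂ) (i : Fin N) :
    (2 : ℂ) • edgeRow e z i = cornerVec z (fun c => if 𝒯.edge c = e i then 1 else 0) := by
  funext j
  rw [cornerVec_apply, ← OrientedEdge.sum_eq_two_mul]
  · rw [Pi.smul_apply, smul_eq_mul]
    congr 1
    have h1 : ∀ q, (𝒯.incidence (e i) j q : ℂ) = ∑ p : OrientedEdge,
        if p.1.1 < p.1.2 then if p.quad = q ∧ 𝒯.edge (p.corner j) = e i then 1 else 0 else 0 := by
      intro q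
      have := congrArg (Int.cast : ℤ → ℂ) (𝒯.incidence_eq_sum (e i) j q)
      push_cast at this
      exact this
    simp only [edgeRow, h1, Finset.sum_mul]
    rw [Finset.sum_comm]
    refine Finset.sum_congr rfl fun p _ => ?_
    by_cases h2 : p.1.1 < p.1.2
    · by_cases h3 : 𝒯.edge (p.corner j) = e i
      · simp [h2, h3]
      · simp [h3]
    · simp [h2]
  · intro p
    rw [OrientedEdge.corner_rev, Gluing.edge_rev, OrientedEdge.quad_rev]

lemma sum_edgeRow (e : Fin N ≃ 𝒯.Edge) (z : Fin N → ℂ) (h0 : ∀ j, z j ≠ 0)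
    (h1 : ∀ j, z j ≠ 1) : ∑ i, edgeRow e z i = 0 := by
  classical
  have h2 : (2 : ℂ) • ∑ i, edgeRow e z i = 0 := by
    rw [Finset.smul_sum, Finset.sum_congr rfl fun i _ => two_smul_edgeRow e z i, ← map_sum,
      ← cornerVec_triangle z h0 h1 (fun _ _ => 1)]
    congr 1
    funext c
    rw [Finset.sum_apply, Finset.sum_eq_single (e.symm (𝒯.edge c))]
    · simp
    · intro i _ hi
      rw [if_neg]
      intro h
      exact hi (by rw [h, Equiv.symm_apply_apply])
    · simp
  exact (smul_eq_zero.mp h2).resolve_left two_ne_zero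

/-- The determinant of the matrix of the gluing equations with one row replaced by a given vector,
as a linear functional. -/
def rowDet (e : Fin N ≃ 𝒯.Edge) (z : Fin N → ℂ) (r : Fin N) : (Fin N → ℂ) →ₗ[ℂ] ℂ where
  toFun V := ((Matrix.of (edgeRow e z)).updateRow r V).det
  map_add' _ _ := Matrix.det_updateRow_add _ _ _ _
  map_smul' _ _ := Matrix.det_updateRow_smul _ _ _ _

lemma rowDet_edgeRow (e : Fin N ≃ 𝒯.Edge) (z : Fin N → ℂ) (h0 : ∀ j, z j ≠ 0)
    (h1 : ∀ j, z j ≠ 1) (r i : Fin N) : rowDet e z r (edgeRow e z i) = 0 := by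
  have hne : ∀ i, i ≠ r → rowDet e z r (edgeRow e z i) = 0 := by
    intro i hi
    refine Matrix.det_zero_of_row_eq hi ?_
    rw [Matrix.updateRow_self, Matrix.updateRow_ne hi]
    rfl
  by_cases hi : i = r
  · subst hi
    have h2 := congrArg (rowDet e z i) (sum_edgeRow e z h0 h1)
    rw [map_sum, map_zero, Finset.sum_eq_single i (fun k _ hk => hne k hk) (by simp)] at h2
    exact h2
  · exact hne i hi

/-- The functional `rowDet` vanishes on functions of the vertices of the boundary, because
symmetrization turns them into functions of the edges. -/
lemma rowDet_cornerVec_vertex (e : Fin N ≃ 𝒯.Edge) (z : Fin N → ℂ) (h0 : ∀ j, z j ≠ 0)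
    (h1 : ∀ j, z j ≠ 1) (r : Fin N) (u : Corner (Fin N) → ℂ)
    (hu : ∀ c f, f ≠ c.v → f ≠ c.w → u (𝒯.cross f c) = u c) : rowDet e z r (cornerVec z u) = 0 := by
  classical
  let w : 𝒯.Edge → ℂ := Quot.lift (fun c => u c + u c.rev) (by
    rintro c d (⟨f, hv, hw, rfl⟩ | rfl)
    · have h2 : (𝒯.cross f c).rev = 𝒯.cross f c.rev := rfl
      rw [h2, hu c f hv hw, hu c.rev f hw hv]
    · exact add_comm _ _)
  have h2 : (2 : ℂ) • cornerVec z u = ∑ i, w (e i) • ((2 : ℂ) • edgeRow e z i) := by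
    rw [Finset.sum_congr rfl fun i _ => by rw [two_smul_edgeRow e z i, ← map_smul], ← map_sum,
      two_smul]
    nth_rewrite 2 [← cornerVec_rev]
    rw [← map_add]
    congr 1
    funext c
    rw [Finset.sum_apply, Finset.sum_eq_single (e.symm (𝒯.edge c))]
    · simp only [Pi.smul_apply, Equiv.apply_symm_apply, if_true, smul_eq_mul, mul_one, Pi.add_apply]
      rfl
    · intro i _ hi
      rw [Pi.smul_apply, if_neg, smul_zero]
      intro h
      exact hi (by rw [h, Equiv.symm_apply_apply])
    · simp
  have h3 := congrArg (rowDet e z r) h2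
  rw [map_smul, map_sum, Finset.sum_eq_zero] at h3
  · exact (smul_eq_zero.mp h3).resolve_left two_ne_zero
  · intro i _
    rw [map_smul, map_smul, rowDet_edgeRow e z h0 h1, smul_zero, smul_zero]

lemma rowDet_cornerVec_eq_zero (e : Fin N ≃ 𝒯.Edge) (z : Fin N → ℂ) (h0 : ∀ j, z j ≠ 0)
    (h1 : ∀ j, z j ≠ 1) (r : Fin N) {Φ u : Corner (Fin N) → ℚ}
    (h : Gluing.IsVertexAddTriangle 𝒯 Φ u) :
    rowDet e z r (cornerVec z (fun c => (Φ c : ℂ))) = 0 := by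
  have hne : ∀ v : Fin 4, v ≠ v + 1 := by decide
  let g : Fin N → Fin 4 → ℂ := fun j v =>
    (Φ ⟨j, v, v + 1, hne v⟩ : ℂ) - (u ⟨j, v, v + 1, hne v⟩ : ℂ)
  have h2 : (fun c : Corner (Fin N) => (Φ c : ℂ)) =
      (fun c => (u c : ℂ)) + fun c => g c.tet c.v := by
    funext c
    have h3 := congrArg (Rat.cast : ℚ → ℂ)
      (h.triangle c ⟨c.tet, c.v, c.v + 1, hne c.v⟩ rfl rfl)
    push_cast at h3
    simp only [Pi.add_apply, g]
    rw [← h3]; ring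
  rw [h2, map_add, map_add, cornerVec_triangle z h0 h1 g, map_zero, add_zero]
  refine rowDet_cornerVec_vertex e z h0 h1 r _ fun c f hv hw => ?_
  rw [h.vertex c f hv hw]

/-- The 1-loop invariant in terms of the corner count of the curve. -/
lemma oneLoop_eq (e : Fin N ≃ 𝒯.Edge) (r : Fin N) (γ : 𝒯.NormalCurve) (z : Fin N → ℂ)
    (h0 : ∀ j, z j ≠ 0) (h1 : ∀ j, z j ≠ 1) (f : Fin 3 → Fin N → ℤ) :
    oneLoop e r γ z f =
      rowDet e z r (cornerVec z (fun c => (γ.cornerCount c : ℂ))) / (2 * flatFactor z f) := by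
  rw [oneLoop]
  congr 1
  change _ = Matrix.det _
  congr 1
  ext i j
  have hz := sum_zeta (z j) (h0 j) (h1 j)
  rw [Fin.sum_univ_three] at hz
  simp only [Matrix.add_apply, Matrix.mul_diagonal, Matrix.map_apply, Matrix.sub_apply, Ghat]
  by_cases hi : i = r
  · subst hi
    simp only [Matrix.updateRow_self, cornerVec_cornerCount]
    rw [Fin.sum_univ_three]
    push_cast
    linear_combination -(γ.row 1 j : ℂ) * hz
  · simp only [Matrix.updateRow_ne hi, G, edgeRow, Matrix.of_apply]
    rw [Fin.sum_univ_three]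
    push_cast
    linear_combination -(𝒯.incidence (e i) j 1 : ℂ) * hz

/-! ### The twisted matrix and the derivative of its determinant -/

lemma value_eq_eval₂ (p : ℂ[T;T⁻¹]) (t : ℂˣ) :
    value p t = LaurentPolynomial.eval₂ (RingHom.id ℂ) t p := by
  have h : value p t = p.smeval t := by
    rw [LaurentPolynomial.smeval_eq_sum, value]
    simp only [smul_eq_mul, Units.val_zpow_eq_zpow_val]
  rw [h]
  induction p using LaurentPolynomial.induction_on' with
  | add p q hp hq =>
    rw [LaurentPolynomial.smeval_add, map_add, hp, hq]
    · rw [LaurentPolynomial.smeval_eq_sum, value]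
      simp only [smul_eq_mul, Units.val_zpow_eq_zpow_val]
    · rw [LaurentPolynomial.smeval_eq_sum, value]
      simp only [smul_eq_mul, Units.val_zpow_eq_zpow_val]
  | C_mul_T n a =>
    rw [LaurentPolynomial.smeval_C_mul_T_n, LaurentPolynomial.eval₂_C_mul_T]
    rfl

lemma differentiableAt_value (p : ℂ[T;T⁻¹]) : DifferentiableAt ℂ (value p) 1 := by
  unfold value
  simp only [Finsupp.sum]
  refine DifferentiableAt.fun_sum fun k _ => ?_
  exact (differentiableAt_zpow.mpr (Or.inl one_ne_zero)).const_mul _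

/-- The matrix `A(t) diag(ζ) + B(t) diag(ζ'')`. -/
def twistedMatrix (α : 𝒯.Cocycle) (lift : Fin N → (Gluing.cover α).Edge) (z : Fin N → ℂ) :
    Matrix (Fin N) (Fin N) ℂ[T;T⁻¹] :=
  (Gt α lift 0 - Gt α lift 1).map toComplex *
      Matrix.diagonal (fun j => LaurentPolynomial.C (zeta (z j) 0)) +
    (Gt α lift 2 - Gt α lift 1).map toComplex *
      Matrix.diagonal (fun j => LaurentPolynomial.C (zeta (z j) 2))

open Classical in
lemma Gt_eq_sum (α : 𝒯.Cocycle) (e : Fin N ≃ 𝒯.Edge) (lift : Fin N → (Gluing.cover α).Edge)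
    (k : Corner (Fin N) → ℤ)
    (hk : ∀ i m c, (Gluing.cover α).edge (Gluing.liftCorner m c) = lift i ↔
      𝒯.edge c = e i ∧ m = k c) (q : Fin 3) (i j : Fin N) :
    Gt α lift q i j = ∑ p : OrientedEdge, if p.1.1 < p.1.2 then
      if p.quad = q ∧ 𝒯.edge (p.corner j) = e i then LaurentPolynomial.T (k (p.corner j)) else 0
      else 0 := by
  have h1 : ∀ m : ℤ, LaurentPolynomial.C ((Gluing.cover α).incidence (lift i) (m, j) q : ℤ) *
      LaurentPolynomial.T m = ∑ p : OrientedEdge, if m = k (p.corner j) then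
        (if p.1.1 < p.1.2 then if p.quad = q ∧ 𝒯.edge (p.corner j) = e i then
          (LaurentPolynomial.T (k (p.corner j)) : ℤ[T;T⁻¹]) else 0 else 0) else 0 := by
    intro m
    rw [Gluing.incidence_eq_sum, map_sum, Finset.sum_mul]
    refine Finset.sum_congr rfl fun p _ => ?_
    rw [show p.corner (m, j) = Gluing.liftCorner m (p.corner j) from rfl, hk]
    by_cases hm : m = k (p.corner j)
    · subst hm
      by_cases h2 : p.1.1 < p.1.2
      · by_cases h3 : p.quad = q ∧ 𝒯.edge (p.corner j) = e i
        · simp [h2, h3.1, h3.2]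
        · simp [h2, h3]
      · simp [h2]
    · simp [hm]
  rw [Gt, Matrix.of_apply, finsum_congr h1,
    finsum_eq_sum_of_support_subset _
      (s := Finset.univ.image fun p : OrientedEdge => k (p.corner j)), Finset.sum_comm]
  · refine Finset.sum_congr rfl fun p _ => ?_
    rw [Finset.sum_ite_eq', if_pos (Finset.mem_image_of_mem _ (Finset.mem_univ p))]
  · intro m hm
    rw [Function.mem_support] at hm
    obtain ⟨p, -, hp⟩ := Finset.exists_ne_zero_of_sum_ne_zero hm
    have : m = k (p.corner j) := by
      by_contra h
      exact hp (if_neg h)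
    rw [this]
    exact Finset.mem_coe.mpr (Finset.mem_image_of_mem _ (Finset.mem_univ p))

lemma toComplex_T (n : ℤ) : toComplex (LaurentPolynomial.T n) = LaurentPolynomial.T n := by
  refine LaurentPolynomial.ext fun m => ?_
  rw [toComplex, AddMonoidAlgebra.coeff_mapRingHom, LaurentPolynomial.T_apply,
    LaurentPolynomial.T_apply]
  split_ifs <;> simp

open Classical in
/-- The values of the entries of the twisted matrix. -/
lemma eval_twistedMatrix (α : 𝒯.Cocycle) (e : Fin N ≃ 𝒯.Edge)
    (lift : Fin N → (Gluing.cover α).Edge) (k : Corner (Fin N) → ℤ)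
    (hk : ∀ i m c, (Gluing.cover α).edge (Gluing.liftCorner m c) = lift i ↔
      𝒯.edge c = e i ∧ m = k c) (hrev : ∀ c, k c.rev = k c) (z : Fin N → ℂ)
    (h0 : ∀ j, z j ≠ 0) (h1 : ∀ j, z j ≠ 1) (t : ℂˣ) (i : Fin N) :
    (2 : ℂ) • (fun j => LaurentPolynomial.eval₂ (RingHom.id ℂ) t (twistedMatrix α lift z i j)) =
      cornerVec z (fun c => if 𝒯.edge c = e i then (t : ℂ) ^ k c else 0) := by
  funext j
  have hG : ∀ q, LaurentPolynomial.eval₂ (RingHom.id ℂ) t (toComplex (Gt α lift q i j)) =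
      ∑ p : OrientedEdge, if p.1.1 < p.1.2 then
        if p.quad = q ∧ 𝒯.edge (p.corner j) = e i then (t : ℂ) ^ k (p.corner j) else 0 else 0 := by
    intro q
    rw [Gt_eq_sum α e lift k hk, map_sum, map_sum]
    refine Finset.sum_congr rfl fun p _ => ?_
    split_ifs
    · rw [toComplex_T, LaurentPolynomial.eval₂_T, Units.val_zpow_eq_zpow_val]
    · simp
    · simp
  have hz := sum_zeta (z j) (h0 j) (h1 j)
  rw [Fin.sum_univ_three] at hz
  have hW : LaurentPolynomial.eval₂ (RingHom.id ℂ) t (twistedMatrix α lift z i j) =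
      ∑ q, LaurentPolynomial.eval₂ (RingHom.id ℂ) t (toComplex (Gt α lift q i j)) *
        zeta (z j) q := by
    simp only [twistedMatrix, Matrix.add_apply, Matrix.mul_diagonal, Matrix.map_apply,
      Matrix.sub_apply, map_add, map_sub, map_mul, LaurentPolynomial.eval₂_C, RingHom.id_apply]
    rw [Fin.sum_univ_three]
    linear_combination
      -(LaurentPolynomial.eval₂ (RingHom.id ℂ) t (toComplex (Gt α lift 1 i j))) * hz
  rw [cornerVec_apply, ← OrientedEdge.sum_eq_two_mul]
  · rw [Pi.smul_apply, smul_eq_mul, hW]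
    congr 1
    simp only [hG, Finset.sum_mul]
    rw [Finset.sum_comm]
    refine Finset.sum_congr rfl fun p _ => ?_
    by_cases h2 : p.1.1 < p.1.2
    · by_cases h3 : 𝒯.edge (p.corner j) = e i
      · simp [h2, h3]
      · simp [h3]
    · simp [h2]
  · intro p
    rw [OrientedEdge.corner_rev, Gluing.edge_rev, OrientedEdge.quad_rev, hrev]

/-- Expansion of a determinant along a row which is replaced by a given vector. -/
lemma det_updateRow_eq_sum {R : Type*} [CommRing R] (A : Matrix (Fin N) (Fin N) R) (r : Fin N)
    (V : Fin N → R) :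
    (A.updateRow r V).det = ∑ j, V j * (A.updateRow r (Pi.single j 1)).det := by
  rw [Matrix.det_eq_sum_mul_adjugate_row _ r]
  refine Finset.sum_congr rfl fun j _ => ?_
  rw [Matrix.adjugate_apply, Matrix.updateRow_self, Matrix.updateRow_idem]

/-- The determinant of the twisted matrix vanishes at `1`, as the sum of all rows does, and its
derivative is obtained by replacing a row by the derivative of the sum of all rows. -/
lemma hasDerivAt_det_twistedMatrix (α : 𝒯.Cocycle) (e : Fin N ≃ 𝒯.Edge)
    (lift : Fin N → (Gluing.cover α).Edge) (k : Corner (Fin N) → ℤ)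
    (hk : ∀ i m c, (Gluing.cover α).edge (Gluing.liftCorner m c) = lift i ↔
      𝒯.edge c = e i ∧ m = k c) (hrev : ∀ c, k c.rev = k c) (z : Fin N → ℂ)
    (h0 : ∀ j, z j ≠ 0) (h1 : ∀ j, z j ≠ 1) (r : Fin N) :
    value (twistedMatrix α lift z).det 1 = 0 ∧
    HasDerivAt (value (twistedMatrix α lift z).det)
      (2⁻¹ * rowDet e z r (cornerVec z (fun c => (k c : ℂ)))) 1 := by
  classical
  set W := twistedMatrix α lift z
  let S : Fin N → ℂ[T;T⁻¹] := fun j => ∑ i, W i j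
  let cof : Fin N → ℂ[T;T⁻¹] := fun j => (W.updateRow r (Pi.single j 1)).det
  let s : Fin N → ℂ → ℂ := fun j t =>
    2⁻¹ * ∑ p : OrientedEdge, t ^ k (p.corner j) * zeta (z j) p.quad
  have hdet : W.det = ∑ j, S j * cof j := by
    have h2 := Matrix.det_updateRow_sum W r (fun _ => 1)
    rw [one_smul] at h2
    rw [← h2, det_updateRow_eq_sum]
    refine Finset.sum_congr rfl fun j _ => ?_
    congr 1
    simp only [one_smul]
    exact Finset.sum_apply j Finset.univ (fun i => W i)
  have hS : ∀ (t : ℂˣ) j, LaurentPolynomial.eval₂ (RingHom.id ℂ) t (S j) = s j t := by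
    intro t j
    have h2 : (2 : ℂ) * LaurentPolynomial.eval₂ (RingHom.id ℂ) t (S j) =
        cornerVec z (fun c => (t : ℂ) ^ k c) j := by
      have h3 : ∀ i, (2 : ℂ) * LaurentPolynomial.eval₂ (RingHom.id ℂ) t (W i j) = _ := fun i =>
        congrFun (eval_twistedMatrix α e lift k hk hrev z h0 h1 t i) j
      simp only [S]
      rw [map_sum, Finset.mul_sum, Finset.sum_congr rfl fun i _ => h3 i, ← Finset.sum_apply,
        ← map_sum]
      refine congrFun (congrArg (cornerVec z) (funext fun c => ?_)) j
      rw [Finset.sum_apply, Finset.sum_eq_single (e.symm (𝒯.edge c))]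
      · simp
      · intro i _ hi
        rw [if_neg]
        intro h
        exact hi (by rw [h, Equiv.symm_apply_apply])
      · simp
    simp only [s]
    rw [← cornerVec_apply z (fun c => (t : ℂ) ^ k c), ← h2]
    ring
  have hs1 : ∀ j, s j 1 = 0 := by
    intro j
    have h2 := OrientedEdge.sum_mul_quad (fun _ => 1) _ (sum_zeta _ (h0 j) (h1 j))
    simp only [s, one_zpow]
    rw [h2, mul_zero]
  have hsd : ∀ j, HasDerivAt (s j) (2⁻¹ * cornerVec z (fun c => (k c : ℂ)) j) 1 := by
    intro j
    refine HasDerivAt.const_mul _ ?_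
    rw [cornerVec_apply]
    refine HasDerivAt.fun_sum fun p _ => HasDerivAt.mul_const ?_ _
    have h2 := hasDerivAt_zpow (k (p.corner j)) (1 : ℂ) (Or.inl one_ne_zero)
    simpa using h2
  have hval : ∀ t : ℂˣ, value W.det t = ∑ j, s j t * value (cof j) t := by
    intro t
    rw [value_eq_eval₂, hdet, map_sum]
    refine Finset.sum_congr rfl fun j _ => ?_
    rw [map_mul, hS, value_eq_eval₂]
  have hcof : ∀ j, value (cof j) 1 =
      ((Matrix.of (edgeRow e z)).updateRow r (Pi.single j 1)).det := by
    intro j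
    have h2 := value_eq_eval₂ (cof j) 1
    rw [Units.val_one] at h2
    rw [h2, RingHom.map_det]
    congr 1
    ext i l
    rw [RingHom.mapMatrix_apply, Matrix.map_apply]
    by_cases hi : i = r
    · subst hi
      rw [Matrix.updateRow_self, Matrix.updateRow_self, Pi.single_apply, Pi.single_apply]
      split_ifs <;> simp
    · rw [Matrix.updateRow_ne hi, Matrix.updateRow_ne hi]
      have h3 := congrFun (eval_twistedMatrix α e lift k hk hrev z h0 h1 1 i) l
      have h4 := congrFun (two_smul_edgeRow e z i) l
      simp only [Units.val_one, one_zpow] at h3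
      rw [← h4] at h3
      simp only [Pi.smul_apply, smul_eq_mul] at h3
      exact mul_left_cancel₀ two_ne_zero h3
  refine ⟨?_, ?_⟩
  · have h2 := hval 1
    simp only [Units.val_one, hs1, zero_mul, Finset.sum_const_zero] at h2
    exact h2
  · have h2 : HasDerivAt (fun t => ∑ j, s j t * value (cof j) t)
        (∑ j, (2⁻¹ * cornerVec z (fun c => (k c : ℂ)) j * value (cof j) 1 +
          s j 1 * deriv (value (cof j)) 1)) 1 :=
      HasDerivAt.fun_sum fun j _ => (hsd j).mul (differentiableAt_value (cof j)).hasDerivAt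
    have h3 : ∑ j, (2⁻¹ * cornerVec z (fun c => (k c : ℂ)) j * value (cof j) 1 +
          s j 1 * deriv (value (cof j)) 1) =
        2⁻¹ * rowDet e z r (cornerVec z (fun c => (k c : ℂ))) := by
      rw [show rowDet e z r (cornerVec z (fun c => (k c : ℂ))) = _ from
        det_updateRow_eq_sum (Matrix.of (edgeRow e z)) r _, Finset.mul_sum]
      refine Finset.sum_congr rfl fun j _ => ?_
      rw [hs1, hcof]
      ring
    rw [h3] at h2
    refine h2.congr_of_eventuallyEq ?_
    filter_upwards [isOpen_ne.mem_nhds (one_ne_zero (α := ℂ))] with t ht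
    exact hval (Units.mk0 t ht)

end Determinants

end TwistedNZ
end

theorem theorem1p7 {N : ℕ} (𝒯 : TwistedNZ.Gluing (Fin N)) (hcusp : 𝒯.IsOneCusped)
    -- the homomorphism `α`, lifts of the tetrahedra, and a peripheral curve `μ` with `α(μ) = 1`
    (α : 𝒯.Cocycle) (μ : 𝒯.NormalCurve) (hμ : μ.IsPeripheral) (hαμ : μ.eval α = 1)
    -- an ordering of the edges, and lifts of the edges
    (e : Fin N ≃ 𝒯.Edge) (lift : Fin N → (TwistedNZ.Gluing.cover α).Edge)
    (hlift : ∀ i, TwistedNZ.Gluing.edgeProj α (lift i) = e i)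
    -- the shapes and a flattening
    (z : Fin N → ℂ) (hz : TwistedNZ.IsCompleteSolution 𝒯 z)
    (f : Fin 3 → Fin N → ℤ) (hf : TwistedNZ.IsFlattening 𝒯 f)
    -- any representative of the twisted 1-loop invariant
    (τ : LaurentPolynomial ℂ)
    (hτ : TwistedNZ.EqUpToUnit τ (TwistedNZ.twistedOneLoop α lift z f)) :
    TwistedNZ.value τ 1 = 0 ∧
    ∀ lam : 𝒯.NormalCurve, lam.IsPeripheral → lam.eval α = 0 →
      -- any ordering of the edges and any replaced row
      ∀ (e' : Fin N ≃ 𝒯.Edge) (r : Fin N), ∃ ε : ℤˣ, HasDerivAt (TwistedNZ.value τ)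
        (((ε : ℤ) : ℂ) * TwistedNZ.oneLoop e' r lam z f) 1 := by
  obtain ⟨ε, m, rfl⟩ := hτ
  have h0 := hz.ne_zero
  have h1 := hz.ne_one
  set D := (TwistedNZ.twistedMatrix α lift z).det with hD
  have hval : ∀ t : ℂˣ, TwistedNZ.value (LaurentPolynomial.C ((ε : ℤ) : ℂ) * LaurentPolynomial.T m *
      TwistedNZ.twistedOneLoop α lift z f) t =
      ((ε : ℤ) : ℂ) * (TwistedNZ.flatFactor z f)⁻¹ * (t : ℂ) ^ m * TwistedNZ.value D t := by
    intro t
    have h2 : TwistedNZ.twistedOneLoop α lift z f =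
      LaurentPolynomial.C (TwistedNZ.flatFactor z f)⁻¹ * D := rfl
    rw [TwistedNZ.value_eq_eval₂, TwistedNZ.value_eq_eval₂, h2]
    simp only [map_mul, LaurentPolynomial.eval₂_C, LaurentPolynomial.eval₂_T, RingHom.id_apply,
      Units.val_zpow_eq_zpow_val]
    ring
  refine ⟨?_, fun lam hper hαlam e' r => ?_⟩
  · obtain ⟨j₀⟩ := hcusp.nonempty
    obtain ⟨k, hk, -, hrev⟩ := TwistedNZ.Gluing.exists_exponent α e lift hlift
    have h2 := (TwistedNZ.hasDerivAt_det_twistedMatrix α e lift k hk hrev z h0 h1 j₀).1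
    have h3 := hval 1
    rw [Units.val_one, h2, mul_zero] at h3
    exact h3
  · -- reorder the lifts of the edges according to `e'`
    let σ : Equiv.Perm (Fin N) := e'.trans e.symm
    have hσ : ∀ i, e (σ i) = e' i := fun i => Equiv.apply_symm_apply _ _
    have hD' : (TwistedNZ.twistedMatrix α (fun i => lift (σ i)) z).det =
        LaurentPolynomial.C (((Equiv.Perm.sign σ : ℤˣ) : ℤ) : ℂ) * D := by
      have h2 := Matrix.det_permute σ (TwistedNZ.twistedMatrix α lift z)
      have h3 : (TwistedNZ.twistedMatrix α lift z).submatrix σ id =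
        TwistedNZ.twistedMatrix α (fun i => lift (σ i)) z := rfl
      rw [h3] at h2
      rw [h2]
      congr 1
    obtain ⟨k, hk, hcross, hrev⟩ := TwistedNZ.Gluing.exists_exponent α e' (fun i => lift (σ i))
      (fun i => by rw [hlift, hσ])
    obtain ⟨-, h2⟩ :=
      TwistedNZ.hasDerivAt_det_twistedMatrix α e' (fun i => lift (σ i)) k hk hrev z h0 h1 r
    obtain ⟨δ, u, hu⟩ := hcusp.exists_sign α μ hαμ k hcross hrev lam hper hαlam
    have h3 := TwistedNZ.rowDet_cornerVec_eq_zero e' z h0 h1 r hu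
    have h4 : TwistedNZ.rowDet e' z r (TwistedNZ.cornerVec z (fun c => (lam.cornerCount c : ℂ))) =
        ((δ : ℤ) : ℂ) * TwistedNZ.rowDet e' z r (TwistedNZ.cornerVec z (fun c => (k c : ℂ))) := by
      have h5 : (fun c => (((lam.cornerCount c : ℚ) - ((δ : ℤ) : ℚ) * k c : ℚ) : ℂ)) =
          (fun c => (lam.cornerCount c : ℂ)) - ((δ : ℤ) : ℂ) • fun c => (k c : ℂ) := by
        funext c
        simp only [Pi.sub_apply, Pi.smul_apply, smul_eq_mul]
        push_cast
        rfl
      rw [h5, map_sub, map_sub, map_smul, map_smul, smul_eq_mul, sub_eq_zero] at h3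
      exact h3
    have hunit : ∀ a : ℤˣ, (((a : ℤ) : ℂ)) * ((a : ℤ) : ℂ) = 1 := by
      intro a
      rw [← Int.cast_mul, ← Units.val_mul, Int.units_mul_self, Units.val_one, Int.cast_one]
    refine ⟨ε * Equiv.Perm.sign σ * δ, ?_⟩
    rw [TwistedNZ.oneLoop_eq e' r lam z h0 h1 f, h4]
    have h6 : HasDerivAt (fun t : ℂ => ((ε : ℤ) : ℂ) * (TwistedNZ.flatFactor z f)⁻¹ *
        (((Equiv.Perm.sign σ : ℤˣ) : ℤ) : ℂ) * t ^ m *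
        TwistedNZ.value (TwistedNZ.twistedMatrix α (fun i => lift (σ i)) z).det t) _ 1 :=
      (((hasDerivAt_zpow m (1 : ℂ) (Or.inl one_ne_zero)).const_mul _).mul h2)
    rw [(TwistedNZ.hasDerivAt_det_twistedMatrix α e' (fun i => lift (σ i)) k hk hrev z h0 h1 r).1,
      mul_zero, zero_add] at h6
    have h7 := h6.congr_of_eventuallyEq (f₁ := TwistedNZ.value (LaurentPolynomial.C ((ε : ℤ) : ℂ) *
      LaurentPolynomial.T m * TwistedNZ.twistedOneLoop α lift z f)) (by
        filter_upwards [isOpen_ne.mem_nhds (one_ne_zero (α := ℂ))] with t ht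
        have h8 := hval (Units.mk0 t ht)
        rw [Units.val_mk0] at h8
        rw [h8, hD']
        have h9 := TwistedNZ.value_eq_eval₂
          (LaurentPolynomial.C (((Equiv.Perm.sign σ : ℤˣ) : ℤ) : ℂ) * D) (Units.mk0 t ht)
        have h10 := TwistedNZ.value_eq_eval₂ D (Units.mk0 t ht)
        rw [Units.val_mk0] at h9 h10
        rw [h9, h10, map_mul, LaurentPolynomial.eval₂_C, RingHom.id_apply]
        linear_combination -(((ε : ℤ) : ℂ) * (TwistedNZ.flatFactor z f)⁻¹ * t ^ m *
          LaurentPolynomial.eval₂ (RingHom.id ℂ) (Units.mk0 t ht) D) * hunit (Equiv.Perm.sign σ))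
    have h8 : ((((ε * Equiv.Perm.sign σ * δ : ℤˣ) : ℤ) : ℂ)) *
        (((δ : ℤ) : ℂ) * TwistedNZ.rowDet e' z r (TwistedNZ.cornerVec z (fun c => (k c : ℂ))) /
          (2 * TwistedNZ.flatFactor z f)) =
        ((ε : ℤ) : ℂ) * (TwistedNZ.flatFactor z f)⁻¹ * (((Equiv.Perm.sign σ : ℤˣ) : ℤ) : ℂ) *
          (1 : ℂ) ^ m *
          (2⁻¹ * TwistedNZ.rowDet e' z r (TwistedNZ.cornerVec z (fun c => (k c : ℂ)))) := by
      rw [one_zpow, mul_one]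
      push_cast
      rw [div_eq_mul_inv, mul_inv]
      linear_combination (((ε : ℤ) : ℂ) * (((Equiv.Perm.sign σ : ℤˣ) : ℤ) : ℂ) * 2⁻¹ *
        (TwistedNZ.flatFactor z f)⁻¹ *
        TwistedNZ.rowDet e' z r (TwistedNZ.cornerVec z (fun c => (k c : ℂ)))) * hunit δ
    rw [h8]
    exact h7
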